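/- Let $\mathcal X,\mathcal Y,\mathcal Z$ be finite sets and let $W$ be a two-user discrete memoryless multiple access channel (MAC), i.e. for each $(x,y)\in\mathcal X\times\mathcal Y$ a probability distribution $W(\cdot\mid x,y)$ on $\mathcal Z$; write $W^n(\mathbf z\mid\mathbf x,\mathbf y)=\prod_{t=1}^n W(z_t\mid x_t,y_t)$. An $(N_1,N_2,n)$ adversary identifying code consists of deterministic encoders $f_1:\mathcal M_1\to\mathcal X^n$, $f_2:\mathcal M_2\to\mathcal Y^n$, where $\mathcal M_i=\{1,\dots,N_i\}$, and a deterministic decoder $\phi:\mathcal Z^n\to(\mathcal M_1\times\mathcal M_2)\cup\{\mathbf b_1,\mathbf b_2\}$, where the symbol $\mathbf b_i$ declares user $i$ adversarial. Its probability of error is $P_e=\max\{P_0,P_1,P_2\}$, where $$P_0=\frac1{N_1N_2}\sum_{m_1,m_2}W^n\big(\{\mathbf z:\phi(\mathbf z)\ne(m_1,m_2)\}\,\big|\,f_1(m_1),f_2(m_2)\big),$$ $$P_1=\max_{\mathbf x\in\mathcal X^n}\frac1{N_2}\sum_{m_2}W^n\big(\{\mathbf z:\phi(\mathbf z)\notin(\mathcal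 M_1\times\{m_2\})\cup\{\mathbf b_1\}\}\,\big|\,\mathbf x,f_2(m_2)\big),$$ $$P_2=\max_{\mathbf y\in\mathcal Y^n}\frac1{N_1}\sum_{m_1}W^n\big(\{\mathbf z:\phi(\mathbf z)\notin(\{m_1\}\times\mathcal M_2)\cup\{\mathbf b_2\}\}\,\big|\,f_1(m_1),\mathbf y\big).$$ A pair $(R_1,R_2)$ of nonnegative reals is achievable if there is a sequence of $(\lfloor2^{nR_1}\rfloor,\lfloor2^{nR_2}\rfloor,n)$ adversary identifying codes whose probability of error tends to $0$ as $n\to\infty$. The capacity region $\mathcal C\subseteq\mathbb R^2$ of communication with adversary identification is the closure of the set of achievable pairs. The MAC $W$ is $1$-spoofable if there are conditional distributions $Q_{Y|\tilde X,\tilde Y}$ and $Q_{X|\tilde X,X'}$ such that for all $x',\tilde x\in\mathcal X$, $\tilde y\in\mathcal Y$, $z\in\mathcal Z$, $$\sum_y Q_{Y|\tilde X,\tilde Y}(y|\tilde x,\tilde y)W(z|x',y)=\sum_y Q_{Y|\tilde X,\tilde Y}(y|x',\tilde y)W(z|\tilde x,y)=\sum_x Q_{X|\tilde X,X'}(x|\tilde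 x,x')W(z|x,\tilde y).$$ It is $2$-spoofable if there are conditional distributions $Q_{X|\tilde X,\tilde Y}$ and $Q_{Y|\tilde Y,Y'}$ such that for all $\tilde x\in\mathcal X$, $\tilde y,y'\in\mathcal Y$, $z\in\mathcal Z$, $$\sum_x Q_{X|\tilde X,\tilde Y}(x|\tilde x,\tilde y)W(z|x,y')=\sum_x Q_{X|\tilde X,\tilde Y}(x|\tilde x,y')W(z|x,\tilde y)=\sum_y Q_{Y|\tilde Y,Y'}(y|\tilde y,y')W(z|\tilde x,y).$$ It is spoofable if it is $1$-spoofable or $2$-spoofable. Then the interior of $\mathcal C$ in $\mathbb R^2$ is empty if and only if $W$ is spoofable. -/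

import Mathlib

open Filter Topology

namespace ByzantineMAC

/-- A two-user discrete memoryless multiple access channel with input alphabets `X`, `Y` and
output alphabet `Z`: for each input pair `(x, y)`, the distribution `W(· | x, y)` on `Z`. -/
abbrev MAC (X Y Z : Type*) [Fintype Z] := X → Y → stdSimplex ℝ Z

/-- What the decoder may output: a pair of messages, or an accusation of one of the two users. -/
inductive Output (N₁ N₂ : ℕ) where
  | messages (m₁ : Fin N₁) (m₂ : Fin N₂)
  | blame₁
  | blame₂

/-- A deterministic `(N₁, N₂, n)` adversary identifying code. -/
structure Code (X Y Z : Type*) (N₁ N₂ n : ℕ) where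
  enc₁ : Fin N₁ → Fin n → X
  enc₂ : Fin N₂ → Fin n → Y
  dec : (Fin n → Z) → Output N₁ N₂

section ErrorProbability

variable {X Y Z : Type*} [Fintype Z] {N₁ N₂ n : ℕ}

open Classical in
/-- `Wⁿ(E | x, y)`: the probability that the output of `n` independent uses of `W` on the input
sequences `x`, `y` lies in `E`. -/
noncomputable def blockProb (W : MAC X Y Z) (x : Fin n → X) (y : Fin n → Y)
    (E : Set (Fin n → Z)) : ℝ :=
  ∑ z : Fin n → Z, if z ∈ E then ∏ t, (W (x t) (y t)).1 (z t) else 0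

/-- The error event for the message pair `(m₁, m₂)` when both users are honest. -/
def Code.errNone (c : Code X Y Z N₁ N₂ n) (m₁ : Fin N₁) (m₂ : Fin N₂) : Set (Fin n → Z) :=
  {z | c.dec z ≠ Output.messages m₁ m₂}

/-- The error event for the message `m₂` of the honest user 2 when user 1 is adversarial. -/
def Code.errAdv₁ (c : Code X Y Z N₁ N₂ n) (m₂ : Fin N₂) : Set (Fin n → Z) :=
  {z | ¬ ((∃ m₁, c.dec z = Output.messages m₁ m₂) ∨ c.dec z = Output.blame₁)}

/-- The error event for the message `m₁` of the honest user 1 when user 2 is adversarial. -/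
def Code.errAdv₂ (c : Code X Y Z N₁ N₂ n) (m₁ : Fin N₁) : Set (Fin n → Z) :=
  {z | ¬ ((∃ m₂, c.dec z = Output.messages m₁ m₂) ∨ c.dec z = Output.blame₂)}

/-- Average probability of error when both users are honest. -/
noncomputable def probErrNone (W : MAC X Y Z) (c : Code X Y Z N₁ N₂ n) : ℝ :=
  (1 / ((N₁ : ℝ) * (N₂ : ℝ))) *
    ∑ m₁, ∑ m₂, blockProb W (c.enc₁ m₁) (c.enc₂ m₂) (c.errNone m₁ m₂)

/-- Average probability of error when user 1 is adversarial, maximized over its input sequences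
(a maximum over the finite set `Xⁿ` if `X` is finite). -/
noncomputable def probErrAdv₁ (W : MAC X Y Z) (c : Code X Y Z N₁ N₂ n) : ℝ :=
  ⨆ x : Fin n → X, (1 / (N₂ : ℝ)) * ∑ m₂, blockProb W x (c.enc₂ m₂) (c.errAdv₁ m₂)

/-- Average probability of error when user 2 is adversarial, maximized over its input sequences
(a maximum over the finite set `Yⁿ` if `Y` is finite). -/
noncomputable def probErrAdv₂ (W : MAC X Y Z) (c : Code X Y Z N₁ N₂ n) : ℝ :=
  ⨆ y : Fin n → Y, (1 / (N₁ : ℝ)) * ∑ m₁, blockProb W (c.enc₁ m₁) y (c.errAdv₂ m₁)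

/-- The average probability of error of a code: the worst of the three cases. -/
noncomputable def probErr (W : MAC X Y Z) (c : Code X Y Z N₁ N₂ n) : ℝ :=
  max (probErrNone W c) (max (probErrAdv₁ W c) (probErrAdv₂ W c))

end ErrorProbability

section Capacity

variable {X Y Z : Type*} [Fintype Z]

/-- A pair of nonnegative rates is achievable if some sequence of
`(⌊2 ^ (n R₁)⌋, ⌊2 ^ (n R₂)⌋, n)` codes has probability of error tending to `0`.
(The term `n = 0` is harmless: a `(1, 1, 0)` code always exists.) -/
def Achievable (W : MAC X Y Z) (R : ℝ × ℝ) : Prop :=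
  0 ≤ R.1 ∧ 0 ≤ R.2 ∧
    ∃ c : ∀ n : ℕ, Code X Y Z ⌊(2 : ℝ) ^ ((n : ℝ) * R.1)⌋₊ ⌊(2 : ℝ) ^ ((n : ℝ) * R.2)⌋₊ n,
      Tendsto (fun n => probErr W (c n)) atTop (𝓝 0)

/-- The capacity region of communication with adversary identification. -/
def capacityRegion (W : MAC X Y Z) : Set (ℝ × ℝ) :=
  closure {R | Achievable W R}

end Capacity

section Spoofability

variable {X Y Z : Type*} [Fintype X] [Fintype Y] [Fintype Z]

/-- `Q x̃ ỹ` is `Q_{Y|X̃,Ỹ}(· | x̃, ỹ)` and `Q' x̃ x'` is `Q_{X|X̃,X'}(· | x̃, x')`. -/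
def Spoofable₁ (W : MAC X Y Z) : Prop :=
  ∃ (Q : X → Y → stdSimplex ℝ Y) (Q' : X → X → stdSimplex ℝ X),
    ∀ (x' x₀ : X) (y₀ : Y) (z : Z),
      ∑ y, (Q x₀ y₀).1 y * (W x' y).1 z = ∑ y, (Q x' y₀).1 y * (W x₀ y).1 z ∧
      ∑ y, (Q x' y₀).1 y * (W x₀ y).1 z = ∑ x, (Q' x₀ x').1 x * (W x y₀).1 z

/-- `Q x̃ ỹ` is `Q_{X|X̃,Ỹ}(· | x̃, ỹ)` and `Q' ỹ y'` is `Q_{Y|Ỹ,Y'}(· | ỹ, y')`. -/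
def Spoofable₂ (W : MAC X Y Z) : Prop :=
  ∃ (Q : X → Y → stdSimplex ℝ X) (Q' : Y → Y → stdSimplex ℝ Y),
    ∀ (x₀ : X) (y₀ y' : Y) (z : Z),
      ∑ x, (Q x₀ y₀).1 x * (W x y').1 z = ∑ x, (Q x₀ y').1 x * (W x y₀).1 z ∧
      ∑ x, (Q x₀ y').1 x * (W x y₀).1 z = ∑ y, (Q' y₀ y').1 y * (W x₀ y).1 z

/-- A MAC is spoofable if it is 1-spoofable or 2-spoofable. -/
def Spoofable (W : MAC X Y Z) : Prop := Spoofable₁ W ∨ Spoofable₂ W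

end Spoofability

end ByzantineMAC

namespace ByzantineMAC

/-! ### Concentration for sums of independent bounded centred variables. -/

section TailBounds

open scoped Classical

variable {A : Type*} [Fintype A] {n : ℕ}

/-! Converse. Let `W` be 1-spoofable, and take messages i ≠ j of user 1 and k of user 2. Three
scenarios produce the same output law: user 1 honestly sends j while user 2 attacks letterwise with
`Q` at the codewords of i and k; user 1 honestly sends i while user 2 attacks from j and k; user 2
honestly sends k while user 1 attacks with `Q'` from i and j. No decoder output is correct in all
three (`Code.mem_errAdv_or`), so the error stays at least 1/6 once user 1 has two messages
(`Spoofable₁.probErr_lower_bound`). Hence the first rate of every achievable pair is 0, and the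
region lies in a line. The 2-spoofable case follows by exchanging the users.

Achievability. A message is accepted when some input sequence of the other user explains the output:
given that input and other codewords, the accepted codeword looks uniform and the output looks
generated by `W`. The decoder returns the accepted pair, or blames a user none of whose messages is
accepted. Two facts make this work.

Acceptances do not conflict. If two messages of user 1 and one of user 2 were accepted together, the
joint type of the three codewords, the three explanations and the output would nearly satisfy linear
equations. An exact solution, symmetrized in the two codewords of user 1, is a spoofing strategy
(`spoofable₁_of_law`), so without one compactness gives a uniform gap (`exists_gap`,
`exists_separation`).

An honest message is usually accepted, whatever the other user sends. Random codebooks of small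
positive rates have nearly orthogonal centred codewords, even after masking by other codewords
(`exists_goodBook`). By Cauchy–Schwarz (`card_mul_sq_le`) only boundedly many of them correlate with
any given attack sequence. This bound is deterministic and uniform in the attack, so no union bound
over attacks is needed. For the remaining messages the output statistics concentrate. All small
positive rate pairs are therefore achievable, and they form an open box. -/

theorem sum_prod_eq_prod_sum (F : Fin n → A → ℝ) :
    ∑ a : Fin n → A, ∏ t, F t (a t) = ∏ t, ∑ a, F t a := by
  rw [Finset.prod_univ_sum, Fintype.piFinset_univ]

/-- Centring removes the linear term of exp(s) ≤ 1 + s + s², valid for |s| ≤ 1. The tilt δ/2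
minimizes the resulting exponent λ² − λδ. -/
theorem exp_moment_le {p F : A → ℝ} (hp : ∀ a, 0 ≤ p a) (hp1 : ∑ a, p a = 1)
    (hF : ∀ a, |F a| ≤ 1) (hm : ∑ a, p a * F a = 0) {δ : ℝ} (hδ : 0 < δ) (hδ1 : δ ≤ 1) :
    ∑ a, p a * Real.exp (δ / 2 * F a - δ ^ 2 / 2) ≤ Real.exp (-(δ ^ 2 / 4)) := by
  have key : ∀ a, p a * Real.exp (δ / 2 * F a) ≤
      p a * (1 + δ ^ 2 / 4) + δ / 2 * (p a * F a) := by
    intro a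
    have hs : |δ / 2 * F a| ≤ 1 := by
      rw [abs_mul, abs_of_pos (by positivity : 0 < δ / 2)]
      nlinarith [hF a, abs_nonneg (F a)]
    have h1 := (abs_le.1 (Real.abs_exp_sub_one_sub_id_le hs)).2
    have h2 : (δ / 2 * F a) ^ 2 ≤ δ ^ 2 / 4 := by
      have : F a ^ 2 ≤ 1 := (sq_le_one_iff_abs_le_one _).2 (hF a)
      nlinarith [sq_nonneg δ]
    have h3 : Real.exp (δ / 2 * F a) ≤ 1 + δ ^ 2 / 4 + δ / 2 * F a := by linarith
    nlinarith [mul_le_mul_of_nonneg_left h3 (hp a)]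
  have h1 : ∑ a, p a * Real.exp (δ / 2 * F a) ≤ 1 + δ ^ 2 / 4 := by
    refine (Finset.sum_le_sum fun a _ => key a).trans ?_
    rw [Finset.sum_add_distrib, ← Finset.sum_mul, ← Finset.mul_sum, hm, hp1]
    linarith
  have h2 : 1 + δ ^ 2 / 4 ≤ Real.exp (δ ^ 2 / 4) := by
    linarith [Real.add_one_le_exp (δ ^ 2 / 4)]
  calc ∑ a, p a * Real.exp (δ / 2 * F a - δ ^ 2 / 2)
      = (∑ a, p a * Real.exp (δ / 2 * F a)) * Real.exp (-(δ ^ 2 / 2)) := by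
        rw [Finset.sum_mul]
        refine Finset.sum_congr rfl fun a _ => ?_
        rw [sub_eq_add_neg, Real.exp_add, mul_assoc]
    _ ≤ Real.exp (δ ^ 2 / 4) * Real.exp (-(δ ^ 2 / 2)) := by
        gcongr
        exact h1.trans h2
    _ = Real.exp (-(δ ^ 2 / 4)) := by
        rw [← Real.exp_add]
        ring_nf

/-- One-sided Hoeffding-type bound for sums of independent centred variables. -/
theorem upper_tail_le {p F : Fin n → A → ℝ} (hp : ∀ t a, 0 ≤ p t a) (hp1 : ∀ t, ∑ a, p t a = 1)
    (hF : ∀ t a, |F t a| ≤ 1) (hm : ∀ t, ∑ a, p t a * F t a = 0) {δ : ℝ} (hδ : 0 < δ)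
    (hδ1 : δ ≤ 1) :
    ∑ a : Fin n → A, (if δ * n < ∑ t, F t (a t) then ∏ t, p t (a t) else 0) ≤
      Real.exp (-(n * δ ^ 2 / 4)) := by
  calc ∑ a : Fin n → A, (if δ * n < ∑ t, F t (a t) then ∏ t, p t (a t) else 0)
      ≤ ∑ a : Fin n → A, ∏ t, (p t (a t) * Real.exp (δ / 2 * F t (a t) - δ ^ 2 / 2)) := by
        refine Finset.sum_le_sum fun a _ => ?_
        have h0 : 0 ≤ ∏ t, p t (a t) := Finset.prod_nonneg fun t _ => hp _ _
        rw [Finset.prod_mul_distrib, ← Real.exp_sum, Finset.sum_sub_distrib, ← Finset.mul_sum]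
        split_ifs with h
        · refine le_mul_of_one_le_right h0 (Real.one_le_exp ?_)
          simp only [Finset.sum_const, Finset.card_univ, Fintype.card_fin, nsmul_eq_mul]
          nlinarith
        · positivity
    _ = ∏ t, ∑ a, p t a * Real.exp (δ / 2 * F t a - δ ^ 2 / 2) :=
        sum_prod_eq_prod_sum fun t a => p t a * Real.exp (δ / 2 * F t a - δ ^ 2 / 2)
    _ ≤ ∏ _t : Fin n, Real.exp (-(δ ^ 2 / 4)) :=
        Finset.prod_le_prod
          (fun t _ => Finset.sum_nonneg fun a _ => mul_nonneg (hp _ _) (Real.exp_pos _).le)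
          fun t _ => exp_moment_le (hp t) (hp1 t) (hF t) (hm t) hδ hδ1
    _ = Real.exp (-(n * δ ^ 2 / 4)) := by
        rw [Finset.prod_const, Finset.card_univ, Fintype.card_fin, ← Real.exp_nat_mul]
        ring_nf

/-- Two-sided Hoeffding-type bound for sums of independent centred variables. -/
theorem tail_le {p F : Fin n → A → ℝ} (hp : ∀ t a, 0 ≤ p t a) (hp1 : ∀ t, ∑ a, p t a = 1)
    (hF : ∀ t a, |F t a| ≤ 1) (hm : ∀ t, ∑ a, p t a * F t a = 0) {δ : ℝ} (hδ : 0 < δ)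
    (hδ1 : δ ≤ 1) :
    ∑ a : Fin n → A, (if δ * n < |∑ t, F t (a t)| then ∏ t, p t (a t) else 0) ≤
      2 * Real.exp (-(n * δ ^ 2 / 4)) := by
  have h1 := upper_tail_le hp hp1 hF hm hδ hδ1
  have h2 := upper_tail_le (F := fun t a => -F t a) hp hp1 (by simpa using hF)
    (by simpa using hm) hδ hδ1
  refine le_trans ?_ ((add_le_add h1 h2).trans_eq (two_mul _).symm)
  rw [← Finset.sum_add_distrib]
  refine Finset.sum_le_sum fun a _ => ?_
  have h0 : 0 ≤ ∏ t, p t (a t) := Finset.prod_nonneg fun t _ => hp _ _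
  rw [Finset.sum_neg_distrib]
  split_ifs with h h' h'' h'' h' h'' h'' <;> first | linarith | skip
  exact absurd (lt_abs.1 h) (by tauto)

end TailBounds

/-! ### Elementary properties of block probabilities. -/

section BlockProb

open scoped Classical

variable {X Y Z : Type*} [Fintype Z] {n : ℕ}

theorem blockProb_nonneg (W : MAC X Y Z) (x : Fin n → X) (y : Fin n → Y) (E : Set (Fin n → Z)) :
    0 ≤ blockProb W x y E :=
  Finset.sum_nonneg fun z _ => by
    split_ifs
    · exact Finset.prod_nonneg fun t _ => (W (x t) (y t)).2.1 _
    · exact le_rfl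

theorem blockProb_mono (W : MAC X Y Z) (x : Fin n → X) (y : Fin n → Y) {E F : Set (Fin n → Z)}
    (h : E ⊆ F) : blockProb W x y E ≤ blockProb W x y F :=
  Finset.sum_le_sum fun z _ => by
    have h0 : 0 ≤ ∏ t, (W (x t) (y t)).1 (z t) :=
      Finset.prod_nonneg fun t _ => (W (x t) (y t)).2.1 _
    by_cases hE : z ∈ E
    · simp [hE, h hE]
    · rw [if_neg hE]
      split_ifs
      · exact h0
      · exact le_rfl

theorem blockProb_univ (W : MAC X Y Z) (x : Fin n → X) (y : Fin n → Y) :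
    blockProb W x y Set.univ = 1 := by
  simp only [blockProb, Set.mem_univ, if_true]
  rw [sum_prod_eq_prod_sum fun t z => (W (x t) (y t)).1 z]
  exact Finset.prod_eq_one fun t _ => (W (x t) (y t)).2.2

theorem blockProb_le_one (W : MAC X Y Z) (x : Fin n → X) (y : Fin n → Y)
    (E : Set (Fin n → Z)) : blockProb W x y E ≤ 1 :=
  (blockProb_mono W x y (Set.subset_univ E)).trans_eq (blockProb_univ W x y)

theorem blockProb_iUnion_le {ι : Type*} [Fintype ι] (W : MAC X Y Z) (x : Fin n → X)
    (y : Fin n → Y) (E : ι → Set (Fin n → Z)) :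
    blockProb W x y (⋃ i, E i) ≤ ∑ i, blockProb W x y (E i) := by
  unfold blockProb
  rw [Finset.sum_comm]
  refine Finset.sum_le_sum fun z _ => ?_
  have h0 : 0 ≤ ∏ t, (W (x t) (y t)).1 (z t) :=
    Finset.prod_nonneg fun t _ => (W (x t) (y t)).2.1 _
  have h1 : ∀ i, 0 ≤ if z ∈ E i then ∏ t, (W (x t) (y t)).1 (z t) else 0 := fun i => by
    split_ifs
    · exact h0
    · exact le_rfl
  split_ifs with h
  · obtain ⟨i, hi⟩ := Set.mem_iUnion.1 h
    refine le_trans (le_of_eq ?_) (Finset.single_le_sum (fun i _ => h1 i) (Finset.mem_univ i))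
    rw [if_pos hi]
  · exact Finset.sum_nonneg fun i _ => h1 i

theorem blockProb_union_le (W : MAC X Y Z) (x : Fin n → X) (y : Fin n → Y)
    (E F : Set (Fin n → Z)) :
    blockProb W x y (E ∪ F) ≤ blockProb W x y E + blockProb W x y F := by
  have h := blockProb_iUnion_le W x y (fun b : Bool => cond b E F)
  rwa [← Set.union_eq_iUnion, Fintype.sum_bool] at h

/-- The channel with the two users exchanged. -/
abbrev swap (W : MAC X Y Z) : MAC Y X Z := fun y x => W x y

end BlockProb

end ByzantineMAC

namespace ByzantineMAC

/-! ### Spoofable channels force a constant error probability. -/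

section Converse

open scoped Classical

variable {X Y Z : Type*} {N₁ N₂ n : ℕ}

/-- An output correct for both i and j of user 1 can only be `blame₂`, which is wrong when user 2 is
the honest one. -/
theorem Code.mem_errAdv_or (c : Code X Y Z N₁ N₂ n) {i j : Fin N₁} (hij : i ≠ j) (k : Fin N₂)
    (z : Fin n → Z) : z ∈ c.errAdv₂ i ∨ z ∈ c.errAdv₂ j ∨ z ∈ c.errAdv₁ k := by
  by_contra! h
  obtain ⟨h1, h2, h3⟩ := h
  replace h1 := not_not.1 h1
  replace h2 := not_not.1 h2
  replace h3 := not_not.1 h3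
  rcases h1 with ⟨m, h1⟩ | h1
  · rcases h2 with ⟨m', h2⟩ | h2
    · exact hij (Output.messages.inj (h1.symm.trans h2)).1
    · cases h1.symm.trans h2
  · rcases h3 with ⟨m', h3⟩ | h3 <;> cases h1.symm.trans h3

variable [Fintype Z]

theorem sum_blockProb_le_of_adv₂ [Fintype Y] (W : MAC X Y Z) (c : Code X Y Z N₁ N₂ n) (hN : 0 < N₁)
    (y : Fin n → Y) :
    ∑ m₁, blockProb W (c.enc₁ m₁) y (c.errAdv₂ m₁) ≤ N₁ * probErr W c := by
  have h1 : (1 / (N₁ : ℝ)) * ∑ m₁, blockProb W (c.enc₁ m₁) y (c.errAdv₂ m₁) ≤ probErr W c :=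
    (le_ciSup (f := fun y : Fin n → Y =>
      (1 / (N₁ : ℝ)) * ∑ m₁, blockProb W (c.enc₁ m₁) y (c.errAdv₂ m₁))
      (Set.finite_range _).bddAbove y).trans ((le_max_right _ _).trans (le_max_right _ _))
  have h2 : (0 : ℝ) < N₁ := by exact_mod_cast hN
  rw [one_div, inv_mul_le_iff₀ h2] at h1
  exact h1

theorem sum_blockProb_le_of_adv₁ [Fintype X] (W : MAC X Y Z) (c : Code X Y Z N₁ N₂ n) (hN : 0 < N₂)
    (x : Fin n → X) :
    ∑ m₂, blockProb W x (c.enc₂ m₂) (c.errAdv₁ m₂) ≤ N₂ * probErr W c := by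
  have h1 : (1 / (N₂ : ℝ)) * ∑ m₂, blockProb W x (c.enc₂ m₂) (c.errAdv₁ m₂) ≤ probErr W c :=
    (le_ciSup (f := fun x : Fin n → X =>
      (1 / (N₂ : ℝ)) * ∑ m₂, blockProb W x (c.enc₂ m₂) (c.errAdv₁ m₂))
      (Set.finite_range _).bddAbove x).trans ((le_max_left _ _).trans (le_max_right _ _))
  have h2 : (0 : ℝ) < N₂ := by exact_mod_cast hN
  rw [one_div, inv_mul_le_iff₀ h2] at h1
  exact h1

/-- A randomized memoryless attack does no better than the best deterministic one. -/
theorem sum_randomized_le {A ι : Type*} [Fintype A] [Fintype ι] (q : Fin n → stdSimplex ℝ A)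
    (V : ι → Fin n → A → Z → ℝ) (E : ι → Set (Fin n → Z)) {b : ℝ}
    (h : ∀ a : Fin n → A, ∑ i, ∑ z, (if z ∈ E i then ∏ t, V i t (a t) (z t) else 0) ≤ b) :
    ∑ i, ∑ z, (if z ∈ E i then ∏ t, ∑ a, (q t).1 a * V i t a (z t) else 0) ≤ b := by
  have h1 : ∑ a : Fin n → A, ∏ t, (q t).1 (a t) = 1 := by
    rw [sum_prod_eq_prod_sum fun t a => (q t).1 a]
    exact Finset.prod_eq_one fun t _ => (q t).2.2
  calc ∑ i, ∑ z, (if z ∈ E i then ∏ t, ∑ a, (q t).1 a * V i t a (z t) else 0)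
      = ∑ a : Fin n → A, (∏ t, (q t).1 (a t)) *
          ∑ i, ∑ z, (if z ∈ E i then ∏ t, V i t (a t) (z t) else 0) := by
        simp_rw [Finset.mul_sum]
        conv_rhs => rw [Finset.sum_comm]
        refine Finset.sum_congr rfl fun i _ => ?_
        conv_rhs => rw [Finset.sum_comm]
        refine Finset.sum_congr rfl fun z _ => ?_
        split_ifs
        -- A product of letterwise mixtures is a mixture over deterministic input sequences.
        · rw [← sum_prod_eq_prod_sum fun t a => (q t).1 a * V i t a (z t)]
          simp_rw [Finset.prod_mul_distrib]
        · simp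
    _ ≤ ∑ a : Fin n → A, (∏ t, (q t).1 (a t)) * b :=
        Finset.sum_le_sum fun a _ => mul_le_mul_of_nonneg_left (h a)
          (Finset.prod_nonneg fun t _ => (q t).2.1 _)
    _ = b := by rw [← Finset.sum_mul, h1, one_mul]

/-- `V i j k` is the common output law of the three attacks. Every triple with i ≠ j carries total
error at least 1, so summing gives N₁(N₁ − 1)N₂ ≤ 3 N₁² N₂ Pₑ. The value 1/6 is (N₁ − 1)/(3N₁) at N₁
= 2. -/
theorem Spoofable₁.probErr_lower_bound [Fintype X] [Fintype Y] {W : MAC X Y Z} (hW : Spoofable₁ W)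
    (c : Code X Y Z N₁ N₂ n) (hN₁ : 2 ≤ N₁) (hN₂ : 0 < N₂) : 1 / 6 ≤ probErr W c := by
  obtain ⟨Q, Q', hQ⟩ := hW
  set V : Fin N₁ → Fin N₁ → Fin N₂ → (Fin n → Z) → ℝ := fun i j k z =>
    ∏ t, ∑ y, (Q (c.enc₁ i t) (c.enc₂ k t)).1 y * (W (c.enc₁ j t) y).1 (z t) with hV
  have hVb : ∀ i j k z, V i j k z =
      ∏ t, ∑ y, (Q (c.enc₁ j t) (c.enc₂ k t)).1 y * (W (c.enc₁ i t) y).1 (z t) := fun i j k z =>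
    Finset.prod_congr rfl fun t _ => (hQ _ _ _ _).1
  have hVc : ∀ i j k z, V i j k z =
      ∏ t, ∑ x, (Q' (c.enc₁ i t) (c.enc₁ j t)).1 x * (W x (c.enc₂ k t)).1 (z t) := fun i j k z =>
    Finset.prod_congr rfl fun t _ => (hQ _ _ _ _).1.trans (hQ _ _ _ _).2
  have hV0 : ∀ i j k z, 0 ≤ V i j k z := fun i j k z =>
    Finset.prod_nonneg fun t _ => Finset.sum_nonneg fun y _ =>
      mul_nonneg ((Q _ _).2.1 _) ((W _ _).2.1 _)
  have hV1 : ∀ i j k, ∑ z, V i j k z = 1 := fun i j k => by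
    rw [hV, sum_prod_eq_prod_sum fun t z =>
      ∑ y, (Q (c.enc₁ i t) (c.enc₂ k t)).1 y * (W (c.enc₁ j t) y).1 z]
    refine Finset.prod_eq_one fun t _ => ?_
    rw [Finset.sum_comm]
    simp_rw [← Finset.mul_sum, (W _ _).2.2, mul_one]
    exact (Q _ _).2.2
  have ha : ∀ i k, ∑ j, ∑ z, (if z ∈ c.errAdv₂ j then V i j k z else 0) ≤ N₁ * probErr W c :=
    fun i k => sum_randomized_le (fun t => Q (c.enc₁ i t) (c.enc₂ k t))
      (fun j t y z => (W (c.enc₁ j t) y).1 z) _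
      fun y => sum_blockProb_le_of_adv₂ W c (by omega) y
  have hb : ∀ j k, ∑ i, ∑ z, (if z ∈ c.errAdv₂ i then V i j k z else 0) ≤ N₁ * probErr W c := by
    intro j k
    simp_rw [hVb]
    exact sum_randomized_le (fun t => Q (c.enc₁ j t) (c.enc₂ k t))
      (fun i t y z => (W (c.enc₁ i t) y).1 z) _
      fun y => sum_blockProb_le_of_adv₂ W c (by omega) y
  have hc : ∀ i j, ∑ k, ∑ z, (if z ∈ c.errAdv₁ k then V i j k z else 0) ≤ N₂ * probErr W c := by
    intro i j
    simp_rw [hVc]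
    exact sum_randomized_le (fun t => Q' (c.enc₁ i t) (c.enc₁ j t))
      (fun k t x z => (W x (c.enc₂ k t)).1 z) _
      fun x => sum_blockProb_le_of_adv₁ W c hN₂ x
  have hcover : ∀ i j k, (if i = j then (0 : ℝ) else 1) ≤
      ∑ z, (if z ∈ c.errAdv₂ j then V i j k z else 0) +
      ∑ z, (if z ∈ c.errAdv₂ i then V i j k z else 0) +
      ∑ z, (if z ∈ c.errAdv₁ k then V i j k z else 0) := by
    intro i j k
    rw [← Finset.sum_add_distrib, ← Finset.sum_add_distrib]
    have hn : ∀ (p : Prop) (z), 0 ≤ if p then V i j k z else 0 := fun p z => by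
      split_ifs
      · exact hV0 _ _ _ _
      · exact le_rfl
    split_ifs with hij
    · exact Finset.sum_nonneg fun z _ => add_nonneg (add_nonneg (hn _ _) (hn _ _)) (hn _ _)
    · rw [← hV1 i j k]
      refine Finset.sum_le_sum fun z _ => ?_
      by_cases h1 : z ∈ c.errAdv₂ j
      · rw [if_pos h1, add_assoc]
        exact le_add_of_nonneg_right (add_nonneg (hn _ _) (hn _ _))
      by_cases h2 : z ∈ c.errAdv₂ i
      · rw [if_pos h2]
        linarith [hn (z ∈ c.errAdv₂ j) z, hn (z ∈ c.errAdv₁ k) z]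
      have h3 : z ∈ c.errAdv₁ k :=
        ((c.mem_errAdv_or hij k z).resolve_left h2).resolve_left h1
      rw [if_pos h3]
      linarith [hn (z ∈ c.errAdv₂ j) z, hn (z ∈ c.errAdv₂ i) z]
  have hsum := Finset.sum_le_sum fun i (_ : i ∈ Finset.univ) =>
    Finset.sum_le_sum fun j (_ : j ∈ Finset.univ) =>
      Finset.sum_le_sum fun k (_ : k ∈ Finset.univ) => hcover i j k
  simp only [Finset.sum_add_distrib] at hsum
  have e1 : ∑ i : Fin N₁, ∑ j : Fin N₁, ∑ _k : Fin N₂, (if i = j then (0 : ℝ) else 1) =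
      N₁ * (N₁ - 1) * N₂ := by
    have : ∀ i j : Fin N₁, (if i = j then (0 : ℝ) else 1) = 1 - if i = j then 1 else 0 :=
      fun i j => by split_ifs <;> simp
    simp only [this, Finset.sum_const, Finset.card_univ, Fintype.card_fin, nsmul_eq_mul,
      ← Finset.mul_sum, Finset.sum_sub_distrib, Finset.sum_ite_eq, Finset.mem_univ, if_true]
    ring
  have e2 : ∑ i, ∑ j, ∑ k, ∑ z, (if z ∈ c.errAdv₂ j then V i j k z else 0) ≤
      N₁ * (N₂ * (N₁ * probErr W c)) := by
    have : ∀ i, ∑ j, ∑ k, ∑ z, (if z ∈ c.errAdv₂ j then V i j k z else 0) ≤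
        N₂ * (N₁ * probErr W c) := fun i => by
      rw [Finset.sum_comm]
      exact (Finset.sum_le_sum fun k _ => ha i k).trans_eq (by simp)
    exact (Finset.sum_le_sum fun i _ => this i).trans_eq (by simp)
  have e3 : ∑ i, ∑ j, ∑ k, ∑ z, (if z ∈ c.errAdv₂ i then V i j k z else 0) ≤
      N₁ * (N₂ * (N₁ * probErr W c)) := by
    rw [Finset.sum_comm]
    have : ∀ j, ∑ i, ∑ k, ∑ z, (if z ∈ c.errAdv₂ i then V i j k z else 0) ≤
        N₂ * (N₁ * probErr W c) := fun j => by
      rw [Finset.sum_comm]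
      exact (Finset.sum_le_sum fun k _ => hb j k).trans_eq (by simp)
    exact (Finset.sum_le_sum fun j _ => this j).trans_eq (by simp)
  have e4 : ∑ i, ∑ j, ∑ k, ∑ z, (if z ∈ c.errAdv₁ k then V i j k z else 0) ≤
      N₁ * (N₁ * (N₂ * probErr W c)) :=
    (Finset.sum_le_sum fun i _ => Finset.sum_le_sum fun j _ => hc i j).trans_eq (by simp)
  rw [e1] at hsum
  have hA : (2 : ℝ) ≤ N₁ := by exact_mod_cast hN₁
  have hB : (0 : ℝ) < N₂ := by exact_mod_cast hN₂
  have hfin : (N₁ * N₂ : ℝ) * (N₁ - 1) ≤ (N₁ * N₂ : ℝ) * (N₁ * (3 * probErr W c)) := by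
    linarith
  have hfin' := le_of_mul_le_mul_left hfin (by positivity)
  by_contra hlt
  push Not at hlt
  nlinarith

end Converse

end ByzantineMAC

namespace ByzantineMAC

/-! ### The acceptance test and the uniqueness of accepted messages. -/

section Consistency

open scoped Classical

/-- If no probability vector annihilates all the functionals `φ j`, then the empirical
distribution of every sequence is bounded away from annihilating them. -/
theorem exists_gap {Ω J : Type*} [Fintype Ω] [Nonempty Ω] [Fintype J] (φ : J → Ω → ℝ)
    (h : ∀ T ∈ stdSimplex ℝ Ω, ∃ j, ∑ ω, T ω * φ j ω ≠ 0) :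
    ∃ η > 0, ∀ n : ℕ, 0 < n → ∀ u : Fin n → Ω, ∃ j, η * n < |∑ t, φ j (u t)| := by
  set G : (Ω → ℝ) → ℝ := fun T => ∑ j, |∑ ω, T ω * φ j ω| with hG
  have hcont : Continuous G := by fun_prop
  obtain ⟨ω₀⟩ := ‹Nonempty Ω›
  obtain ⟨T₀, hT₀, hmin⟩ := (isCompact_stdSimplex ℝ Ω).exists_isMinOn
    ⟨_, single_mem_stdSimplex ℝ ω₀⟩ hcont.continuousOn
  obtain ⟨j₀, hj₀⟩ := h T₀ hT₀
  have hpos : 0 < G T₀ :=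
    Finset.sum_pos' (fun j _ => abs_nonneg _) ⟨j₀, Finset.mem_univ _, abs_pos.2 hj₀⟩
  have hJ : (0 : ℝ) < Fintype.card J := by
    exact_mod_cast Fintype.card_pos_iff.2 ⟨j₀⟩
  -- With the factor 2, a type violating the claim at every j would have `G` at most half its
  -- minimum. The type of `u` is the `T` below.
  refine ⟨G T₀ / (2 * Fintype.card J), by positivity, fun n hn u => ?_⟩
  have hn' : (0 : ℝ) < n := by exact_mod_cast hn
  set T : Ω → ℝ := fun ω => (∑ t, if u t = ω then 1 else 0) / n with hTdef
  have hT : T ∈ stdSimplex ℝ Ω := by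
    refine ⟨fun ω => div_nonneg (Finset.sum_nonneg fun t _ => by split_ifs <;> simp) hn'.le, ?_⟩
    rw [← Finset.sum_div, Finset.sum_comm]
    simp [hn'.ne']
  have hTφ : ∀ j, ∑ ω, T ω * φ j ω = (∑ t, φ j (u t)) / n := fun j => by
    simp_rw [hTdef, div_mul_eq_mul_div, ← Finset.sum_div, Finset.sum_mul]
    rw [Finset.sum_comm]
    simp
  by_contra! hc
  have h1 : G T ≤ ∑ _j : J, G T₀ / (2 * Fintype.card J) := by
    refine Finset.sum_le_sum fun j _ => ?_
    rw [hTφ, abs_div, abs_of_pos hn', div_le_iff₀ hn']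
    exact hc j
  have h2 : G T₀ ≤ G T := hmin hT
  rw [Finset.sum_const, Finset.card_univ, nsmul_eq_mul] at h1
  have h3 : (Fintype.card J : ℝ) * (G T₀ / (2 * Fintype.card J)) = G T₀ / 2 := by
    field_simp
  linarith

variable {X Y Z : Type*} [Fintype X] [Fintype Z]

/-- `Accepts W η cx cy z i`: some input `y` of user 2 explains the output `z` together with the
codeword `cx i`, this codeword being empirically uniform and independent of `y` and of
any other codewords. -/
def Accepts {N₁ N₂ n : ℕ} (W : MAC X Y Z) (η : ℝ) (cx : Fin N₁ → Fin n → X)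
    (cy : Fin N₂ → Fin n → Y) (z : Fin n → Z) (i : Fin N₁) : Prop :=
  ∃ y : Fin n → Y, ∀ k, k ≠ i → ∀ (p q : Fin N₂) (h : X → Y → Y → Bool) (a : X) (b : Y) (c : Z),
    |∑ t, (if h (cx k t) (cy p t) (cy q t) = true ∧ y t = b then (1 : ℝ) else 0) *
      ((if cx i t = a ∧ z t = c then 1 else 0) - (W a b).1 c / Fintype.card X)| ≤ η * n

theorem Accepts.mono {N₁ N₂ n : ℕ} {W : MAC X Y Z} {η η' : ℝ} (hη : η ≤ η')
    {cx : Fin N₁ → Fin n → X} {cy : Fin N₂ → Fin n → Y} {z : Fin n → Z} {i : Fin N₁}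
    (h : Accepts W η cx cy z i) : Accepts W η' cx cy z i := by
  obtain ⟨y, hy⟩ := h
  exact ⟨y, fun k hk p q h a b c => (hy k hk p q h a b c).trans (by gcongr)⟩

variable [Fintype Y]

/-- A law of `(x, x', ỹ, z)` explained by each of the three attack scenarios, up to
normalization, makes the channel spoofable. -/
theorem spoofable₁_of_law [Nonempty X] [Nonempty Y] (W : MAC X Y Z) (M : X → X → Y → Z → ℝ)
    (q₁ q₂ : X → Y → Y → ℝ) (q₃ : X → X → X → ℝ) (h₁ : ∀ x v y, 0 ≤ q₁ x v y)
    (h₂ : ∀ x v y, 0 ≤ q₂ x v y) (h₃ : ∀ x x' u, 0 ≤ q₃ x x' u)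
    (hM : ∑ x, ∑ x', ∑ v, ∑ z, M x x' v z = 1)
    (hM₁ : ∀ x x' v z, M x x' v z = ∑ y, q₁ x' v y * ((W x y).1 z / Fintype.card X))
    (hM₂ : ∀ x x' v z, M x x' v z = ∑ y, q₂ x v y * ((W x' y).1 z / Fintype.card X))
    (hM₃ : ∀ x x' v z, M x x' v z = ∑ u, q₃ x x' u * ((W u v).1 z / Fintype.card Y)) :
    Spoofable₁ W := by
  have hX : (0 : ℝ) < Fintype.card X := by exact_mod_cast Fintype.card_pos
  have hY : (0 : ℝ) < Fintype.card Y := by exact_mod_cast Fintype.card_pos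
  set a : ℝ := (Fintype.card X : ℝ) with ha
  set b : ℝ := (Fintype.card Y : ℝ) with hb
  set m : X → X → Y → ℝ := fun x x' v => ∑ z, M x x' v z with hm
  have m₁ : ∀ x x' v, m x x' v = (∑ y, q₁ x' v y) / a := fun x x' v => by
    simp_rw [hm, hM₁]
    rw [Finset.sum_comm]
    simp_rw [← Finset.mul_sum, ← Finset.sum_div, (W _ _).2.2, mul_one_div, Finset.sum_div]
  have m₂ : ∀ x x' v, m x x' v = (∑ y, q₂ x v y) / a := fun x x' v => by
    simp_rw [hm, hM₂]
    rw [Finset.sum_comm]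
    simp_rw [← Finset.mul_sum, ← Finset.sum_div, (W _ _).2.2, mul_one_div, Finset.sum_div]
  have m₃ : ∀ x x' v, m x x' v = (∑ u, q₃ x x' u) / b := fun x x' v => by
    simp_rw [hm, hM₃]
    rw [Finset.sum_comm]
    simp_rw [← Finset.mul_sum, ← Finset.sum_div, (W _ _).2.2, mul_one_div, Finset.sum_div]
  obtain ⟨x₀⟩ := ‹Nonempty X›
  obtain ⟨y₀⟩ := ‹Nonempty Y›
  -- The first explanation makes the marginal independent of x, the second of x', the third of v;
  -- hence it is uniform.
  have hconst : ∀ x x' v, m x x' v = m x₀ x₀ y₀ := fun x x' v =>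
    ((m₁ x x' v).trans (m₁ x₀ x' v).symm).trans <|
      ((m₂ x₀ x' v).trans (m₂ x₀ x₀ v).symm).trans <| (m₃ x₀ x₀ v).trans (m₃ x₀ x₀ y₀).symm
  have hval : a * a * b * m x₀ x₀ y₀ = 1 := by
    rw [← hM]
    change _ = ∑ x, ∑ x', ∑ v, m x x' v
    simp_rw [hconst]
    simp [ha, hb]
    ring
  have s₁ : ∀ x v, ∑ y, q₁ x v y = a * m x₀ x₀ y₀ := fun x v => by
    rw [← hconst x x v, m₁]
    field_simp
  have s₂ : ∀ x v, ∑ y, q₂ x v y = a * m x₀ x₀ y₀ := fun x v => by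
    rw [← hconst x x v, m₂]
    field_simp
  have s₃ : ∀ x x', ∑ u, q₃ x x' u = b * m x₀ x₀ y₀ := fun x x' => by
    rw [← hconst x x' y₀, m₃]
    field_simp
  -- Spoofing demands a single `Q` for both of user 2's attacks, whereas `q₁` and `q₂` may differ.
  -- Averaging them yields the law `M` symmetrized in x and x', and `q₃` is symmetrized to match.
  refine ⟨fun x v => ⟨fun y => a * b / 2 * (q₁ x v y + q₂ x v y), fun y => ?_, ?_⟩,
    fun x x' => ⟨fun u => a * a / 2 * (q₃ x x' u + q₃ x' x u), fun u => ?_, ?_⟩, ?_⟩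
  · have := h₁ x v y
    have := h₂ x v y
    positivity
  · rw [← Finset.mul_sum, Finset.sum_add_distrib, s₁, s₂]
    linarith
  · have := h₃ x x' u
    have := h₃ x' x u
    positivity
  · rw [← Finset.mul_sum, Finset.sum_add_distrib, s₃, s₃]
    linarith
  have e₁ : ∀ x x' v z, ∑ y, q₁ x' v y * (W x y).1 z = a * M x x' v z := fun x x' v z => by
    rw [hM₁, Finset.mul_sum]
    exact Finset.sum_congr rfl fun y _ => by field_simp
  have e₂ : ∀ x x' v z, ∑ y, q₂ x v y * (W x' y).1 z = a * M x x' v z := fun x x' v z => by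
    rw [hM₂, Finset.mul_sum]
    exact Finset.sum_congr rfl fun y _ => by field_simp
  have e₃ : ∀ x x' v z, ∑ u, q₃ x x' u * (W u v).1 z = b * M x x' v z := fun x x' v z => by
    rw [hM₃, Finset.mul_sum]
    exact Finset.sum_congr rfl fun y _ => by field_simp
  have k₁ : ∀ x x' v z, ∑ y, a * b / 2 * (q₁ x v y + q₂ x v y) * (W x' y).1 z =
      a * a * b / 2 * (M x' x v z + M x x' v z) := fun x x' v z => by
    simp_rw [mul_assoc, add_mul, ← Finset.mul_sum, Finset.sum_add_distrib, e₁, e₂]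
    ring
  have k₂ : ∀ x x' v z, ∑ u, a * a / 2 * (q₃ x x' u + q₃ x' x u) * (W u v).1 z =
      a * a * b / 2 * (M x x' v z + M x' x v z) := fun x x' v z => by
    simp_rw [mul_assoc, add_mul, ← Finset.mul_sum, Finset.sum_add_distrib, e₃]
    ring
  intro x' x v z
  refine ⟨(k₁ x x' v z).trans ((k₁ x' x v z).trans ?_).symm,
    (k₁ x' x v z).trans ((k₂ x x' v z).trans ?_).symm⟩ <;> ring

/-- The joint letters in the three attack scenarios: two codewords of user 1, one codeword of
user 2, the two explanations by inputs of user 2, the one by an input of user 1, the output. -/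
abbrev Joint (X Y Z : Type*) := X × X × Y × Y × Y × X × Z

/-- The functionals of the joint distribution that vanish if all three explanations are exact. -/
noncomputable def discrepancy (W : MAC X Y Z) :
    (X × X × Y × Y × Z) ⊕ (X × X × Y × Y × Z) ⊕ (X × X × Y × X × Z) → Joint X Y Z → ℝ
  | .inl (x, x', v, y, z), (ωx, ωx', ωv, ωy, _, _, ωz) =>
      (if (ωx' = x' ∧ ωv = v) ∧ ωy = y then 1 else 0) *
        ((if ωx = x ∧ ωz = z then 1 else 0) - (W x y).1 z / Fintype.card X)
  | .inr (.inl (x, x', v, y, z)), (ωx, ωx', ωv, _, ωy, _, ωz) =>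
      (if (ωx = x ∧ ωv = v) ∧ ωy = y then 1 else 0) *
        ((if ωx' = x' ∧ ωz = z then 1 else 0) - (W x' y).1 z / Fintype.card X)
  | .inr (.inr (x, x', v, u, z)), (ωx, ωx', ωv, _, _, ωu, ωz) =>
      (if (ωx = x ∧ ωx' = x') ∧ ωu = u then 1 else 0) *
        ((if ωv = v ∧ ωz = z then 1 else 0) - (W u v).1 z / Fintype.card Y)

/-- Total probability over the value of `f`, the letter of the explaining input: the vanishing
functionals say that, given `P` and `f = a`, the event `R` has conditional weight `c a`. -/
theorem sum_mul_sum_ite {Ω A : Type*} [Fintype Ω] [Fintype A] (T : Ω → ℝ) (f : Ω → A)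
    (P R : Ω → Prop) [DecidablePred P] [DecidablePred R] (c : A → ℝ)
    (h : ∀ a, ∑ ω, T ω * ((if P ω ∧ f ω = a then 1 else 0) * ((if R ω then 1 else 0) - c a)) = 0) :
    ∑ ω, T ω * (if P ω ∧ R ω then 1 else 0) =
      ∑ a, (∑ ω, T ω * if P ω ∧ f ω = a then 1 else 0) * c a := by
  have h' : ∀ a, (∑ ω, T ω * if P ω ∧ f ω = a then 1 else 0) * c a =
      ∑ ω, T ω * ((if P ω ∧ f ω = a then 1 else 0) * (if R ω then 1 else 0)) := fun a => by
    refine (sub_eq_zero.1 (Eq.trans ?_ (h a))).symm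
    rw [Finset.sum_mul, ← Finset.sum_sub_distrib]
    exact Finset.sum_congr rfl fun ω _ => by ring
  simp_rw [h']
  rw [Finset.sum_comm]
  refine Finset.sum_congr rfl fun ω _ => ?_
  rw [← Finset.mul_sum, ← Finset.sum_mul]
  congr 1
  by_cases hP : P ω <;> by_cases hR : R ω <;> simp [hP, hR]

theorem spoofable₁_of_discrepancy [Nonempty X] [Nonempty Y] (W : MAC X Y Z)
    {T : Joint X Y Z → ℝ} (hT : T ∈ stdSimplex ℝ (Joint X Y Z))
    (h : ∀ j, ∑ ω, T ω * discrepancy W j ω = 0) : Spoofable₁ W := by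
  have hpos : ∀ (P : Joint X Y Z → Prop) [DecidablePred P],
      0 ≤ ∑ ω, T ω * if P ω then (1 : ℝ) else 0 := fun P _ =>
    Finset.sum_nonneg fun ω _ => mul_nonneg (hT.1 ω) (by split_ifs <;> simp)
  refine spoofable₁_of_law W
    (fun x x' v z => ∑ ω : Joint X Y Z, T ω *
      if ω.1 = x ∧ ω.2.1 = x' ∧ ω.2.2.1 = v ∧ ω.2.2.2.2.2.2 = z then 1 else 0)
    (fun x' v y => ∑ ω : Joint X Y Z, T ω *
      if (ω.2.1 = x' ∧ ω.2.2.1 = v) ∧ ω.2.2.2.1 = y then 1 else 0)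
    (fun x v y => ∑ ω : Joint X Y Z, T ω *
      if (ω.1 = x ∧ ω.2.2.1 = v) ∧ ω.2.2.2.2.1 = y then 1 else 0)
    (fun x x' u => ∑ ω : Joint X Y Z, T ω *
      if (ω.1 = x ∧ ω.2.1 = x') ∧ ω.2.2.2.2.2.1 = u then 1 else 0)
    (fun _ _ _ => hpos _) (fun _ _ _ => hpos _) (fun _ _ _ => hpos _) ?_ ?_ ?_ ?_
  · have e : ∀ (ω : Joint X Y Z), ∑ x, ∑ x', ∑ v, ∑ z, T ω * (if ω.1 = x ∧ ω.2.1 = x' ∧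
        ω.2.2.1 = v ∧ ω.2.2.2.2.2.2 = z then 1 else 0) = T ω := fun ω => by
      simp [ite_and]
    refine Eq.trans ?_ ((Finset.sum_congr rfl fun ω _ => e ω).trans hT.2)
    simp_rw [Finset.sum_comm (s := (Finset.univ : Finset (Joint X Y Z)))]
  · intro x x' v z
    refine Eq.trans ?_ (sum_mul_sum_ite T (fun ω => ω.2.2.2.1)
      (fun ω => ω.2.1 = x' ∧ ω.2.2.1 = v) (fun ω => ω.1 = x ∧ ω.2.2.2.2.2.2 = z)
      (fun y => (W x y).1 z / Fintype.card X) fun y => h (.inl (x, x', v, y, z)))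
    exact Finset.sum_congr rfl fun ω _ => by congr 2; apply propext; tauto
  · intro x x' v z
    refine Eq.trans ?_ (sum_mul_sum_ite T (fun ω => ω.2.2.2.2.1)
      (fun ω => ω.1 = x ∧ ω.2.2.1 = v) (fun ω => ω.2.1 = x' ∧ ω.2.2.2.2.2.2 = z)
      (fun y => (W x' y).1 z / Fintype.card X) fun y => h (.inr (.inl (x, x', v, y, z))))
    exact Finset.sum_congr rfl fun ω _ => by congr 2; apply propext; tauto
  · intro x x' v z
    refine Eq.trans ?_ (sum_mul_sum_ite T (fun ω => ω.2.2.2.2.2.1)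
      (fun ω => ω.1 = x ∧ ω.2.1 = x') (fun ω => ω.2.2.1 = v ∧ ω.2.2.2.2.2.2 = z)
      (fun u => (W u v).1 z / Fintype.card Y) fun u => h (.inr (.inr (x, x', v, u, z))))
    exact Finset.sum_congr rfl fun ω _ => by congr 2; apply propext; tauto

/-- Over a channel that is not 1-spoofable, two messages of user 1 and a message of user 2 are
never accepted together. -/
theorem exists_separation [Nonempty X] [Nonempty Y] [Nonempty Z] (W : MAC X Y Z)
    (hW : ¬ Spoofable₁ W) : ∃ η > 0, ∀ (N₁ N₂ n : ℕ), 2 ≤ N₂ → 0 < n →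
      ∀ (cx : Fin N₁ → Fin n → X) (cy : Fin N₂ → Fin n → Y) (z : Fin n → Z) (i j : Fin N₁)
        (p : Fin N₂), Accepts W η cx cy z i → Accepts W η cx cy z j →
          Accepts (swap W) η cy cx z p → i = j := by
  obtain ⟨η, hη, hgap⟩ := exists_gap (discrepancy W) fun T hT => by
    by_contra! h
    exact hW (spoofable₁_of_discrepancy W hT h)
  refine ⟨η, hη, fun N₁ N₂ n hN hn cx cy z i j p hi hj hp => ?_⟩
  by_contra hij
  obtain ⟨y₁, hi⟩ := hi
  obtain ⟨y₂, hj⟩ := hj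
  obtain ⟨u, hp⟩ := hp
  -- The test for `p` is vacuous without a second codeword of user 2. The chosen `p'` is a dummy,
  -- ignored by the mask used below, which looks only at the codewords of i and j.
  obtain ⟨p', hp'⟩ : ∃ p' : Fin N₂, p' ≠ p := by
    have : Nontrivial (Fin N₂) := Fin.nontrivial_iff_two_le.2 hN
    exact exists_ne p
  obtain ⟨J, hJ⟩ := hgap n hn fun t => (cx i t, cx j t, cy p t, y₁ t, y₂ t, u t, z t)
  refine hJ.not_ge ?_
  -- Each kind of discrepancy is one instance of the acceptance test of i, j or p, with the mask
  -- selecting the letters of the other two codewords.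
  rcases J with ⟨x, x', v, y, c⟩ | ⟨x, x', v, y, c⟩ | ⟨x, x', v, w, c⟩
  · simpa [discrepancy] using
      hi j (Ne.symm hij) p p (fun r s _ => decide (r = x' ∧ s = v)) x y c
  · simpa [discrepancy] using
      hj i hij p p (fun r s _ => decide (r = x ∧ s = v)) x' y c
  · simpa [discrepancy] using
      hp p' hp' i j (fun _ r s => decide (r = x ∧ s = x')) v w c

end Consistency

end ByzantineMAC

namespace ByzantineMAC

/-! ### Pseudorandom codebooks accept honest messages under every attack. -/

section Codebooks

open scoped Classical

/-- The indicator of the letter `a`, centred with respect to the uniform distribution. -/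
noncomputable def centred {X : Type*} [Fintype X] (a x : X) : ℝ :=
  (if x = a then 1 else 0) - 1 / Fintype.card X

/-- The real-valued indicator of a truth value. -/
def flag (b : Bool) : ℝ := if b = true then 1 else 0

theorem abs_centred_le {X : Type*} [Fintype X] (a x : X) : |centred a x| ≤ 1 := by
  have h1 : (1 : ℝ) ≤ Fintype.card X := by
    exact_mod_cast Nat.one_le_iff_ne_zero.2 (Fintype.card_pos_iff.2 ⟨x⟩).ne'
  have h2 : 1 / (Fintype.card X : ℝ) ≤ 1 := by
    rw [div_le_one (by linarith)]
    exact h1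
  have h3 : 0 ≤ 1 / (Fintype.card X : ℝ) := by positivity
  unfold centred
  rw [abs_le]
  split_ifs <;> constructor <;> linarith

theorem abs_flag_le (b : Bool) : |flag b| ≤ 1 := by
  cases b <;> simp [flag]

theorem abs_mul_le_one {r s : ℝ} (hr : |r| ≤ 1) (hs : |s| ≤ 1) : |r * s| ≤ 1 := by
  rw [abs_mul]
  exact mul_le_one₀ hr (abs_nonneg _) hs

theorem abs_sum_le_card {n : ℕ} {f : Fin n → ℝ} (hf : ∀ t, |f t| ≤ 1) : |∑ t, f t| ≤ n :=
  (Finset.abs_sum_le_sum_abs _ _).trans <|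
    (Finset.sum_le_sum fun t _ => hf t).trans_eq (by simp)

/-- Vectors with small pairwise inner products cannot all correlate with one vector. -/
theorem card_mul_sq_le {ι : Type*} {n : ℕ} (hn : 0 < n) (B : Finset ι) (v : ι → Fin n → ℝ)
    (e : Fin n → ℝ) (he : ∀ t, |e t| ≤ 1) {η c : ℝ} (hη : 0 ≤ η) (hc : 0 ≤ c)
    (hB : ∀ i ∈ B, η * n ≤ |∑ t, v i t * e t|)
    (hv : ∀ j ∈ B, ∑ i ∈ B, |∑ t, v i t * v j t| ≤ c * n) : B.card * η ^ 2 ≤ c := by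
  have hn' : (0 : ℝ) < n := by exact_mod_cast hn
  set s : ι → ℝ := fun i => if 0 ≤ ∑ t, v i t * e t then 1 else -1 with hs
  have hs1 : ∀ i, |s i| ≤ 1 := fun i => by
    simp only [hs]
    split_ifs <;> simp
  have hsabs : ∀ i, |∑ t, v i t * e t| = s i * ∑ t, v i t * e t := fun i => by
    simp only [hs]
    split_ifs with h
    · rw [abs_of_nonneg h, one_mul]
    · rw [abs_of_neg (not_le.1 h), neg_one_mul]
  set w : Fin n → ℝ := fun t => ∑ i ∈ B, s i * v i t with hw
  have h1 : B.card * (η * n) ≤ ∑ t, w t * e t := by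
    calc (B.card : ℝ) * (η * n) = ∑ i ∈ B, η * n := by simp
      _ ≤ ∑ i ∈ B, s i * ∑ t, v i t * e t :=
          Finset.sum_le_sum fun i hi => (hB i hi).trans_eq (hsabs i)
      _ = ∑ t, w t * e t := by
          simp_rw [hw, Finset.mul_sum, Finset.sum_mul]
          rw [Finset.sum_comm]
          exact Finset.sum_congr rfl fun t _ => Finset.sum_congr rfl fun i _ => by ring
  have h2 : ∑ t, e t ^ 2 ≤ n :=
    (Finset.sum_le_sum fun t _ => (sq_le_one_iff_abs_le_one _).2 (he t)).trans_eq (by simp)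
  have h3 : ∑ t, w t ^ 2 ≤ B.card * (c * n) := by
    calc ∑ t, w t ^ 2 = ∑ j ∈ B, ∑ i ∈ B, s i * s j * ∑ t, v i t * v j t := by
          simp_rw [hw, sq, Finset.sum_mul_sum, Finset.mul_sum]
          rw [Finset.sum_comm]
          conv_rhs => rw [Finset.sum_comm]
          refine Finset.sum_congr rfl fun i _ => ?_
          rw [Finset.sum_comm]
          exact Finset.sum_congr rfl fun j _ => Finset.sum_congr rfl fun t _ => by ring
      _ ≤ ∑ j ∈ B, ∑ i ∈ B, |∑ t, v i t * v j t| := by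
          refine Finset.sum_le_sum fun j _ => Finset.sum_le_sum fun i _ => ?_
          refine (le_abs_self _).trans ?_
          rw [abs_mul]
          exact mul_le_of_le_one_left (abs_nonneg _) (abs_mul_le_one (hs1 i) (hs1 j))
      _ ≤ B.card * (c * n) := (Finset.sum_le_sum hv).trans_eq (by simp)
  have h4 : (B.card * (η * n)) ^ 2 ≤ B.card * (c * n) * n :=
    calc ((B.card : ℝ) * (η * n)) ^ 2 ≤ (∑ t, w t * e t) ^ 2 :=
          pow_le_pow_left₀ (by positivity) h1 2
      _ ≤ (∑ t, w t ^ 2) * ∑ t, e t ^ 2 := Finset.sum_mul_sq_le_sq_mul_sq _ _ _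
      _ ≤ B.card * (c * n) * n :=
          mul_le_mul h3 h2 (Finset.sum_nonneg fun t _ => sq_nonneg _) (by positivity)
  rcases B.card.eq_zero_or_pos with h0 | h0
  · simpa [h0] using hc
  · have h0' : (0 : ℝ) < B.card := by exact_mod_cast h0
    have h5 : (B.card * n ^ 2 : ℝ) * (B.card * η ^ 2) ≤ (B.card * n ^ 2 : ℝ) * c := by
      nlinarith
    exact le_of_mul_le_mul_left h5 (by positivity)

variable {X Y Z : Type*} [Fintype X] {N₁ N₂ n : ℕ}

/-- Pseudorandomness of a codebook of user 1 relative to a codebook of user 2. -/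
def GoodBook (δ : ℝ) (cx : Fin N₁ → Fin n → X) (cy : Fin N₂ → Fin n → Y) : Prop :=
  ∀ i j k l, i ≠ j → i ≠ k → i ≠ l → ∀ (p q p' q' : Fin N₂) (h : X → Y → Y → Bool) (a : X),
    |∑ t, centred a (cx i t) * (flag (h (cx k t) (cy p t) (cy q t)) *
      (centred a (cx j t) * flag (h (cx l t) (cy p' t) (cy q' t))))| ≤ δ * n

/-- The codewords of user 1 that look dependent on `y` and some other codewords. -/
noncomputable def badSet (η : ℝ) (cx : Fin N₁ → Fin n → X) (cy : Fin N₂ → Fin n → Y)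
    (y : Fin n → Y) (h : X → Y → Y → Bool) (a : X) (b : Y) : Finset (Fin N₁) :=
  {i | ∃ k, k ≠ i ∧ ∃ p q, η * n < |∑ t, centred a (cx i t) *
    flag (h (cx k t) (cy p t) (cy q t)) * if y t = b then 1 else 0|}

/-- Attach to each bad i the centred codeword masked by its witness. Two such vectors i and j have
small inner product except when i = j or i is the witness `k j`, so a row sum is at most (|B|η²/2 +
2)n. `card_mul_sq_le` then gives |B|η² ≤ |B|η²/2 + 2, whatever y is. -/
theorem GoodBook.card_badSet_le (hn : 0 < n) {η : ℝ} (hη : 0 < η)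
    {cx : Fin N₁ → Fin n → X} {cy : Fin N₂ → Fin n → Y} (hG : GoodBook (η ^ 2 / 2) cx cy)
    (y : Fin n → Y) (h : X → Y → Y → Bool) (a : X) (b : Y) :
    ((badSet η cx cy y h a b).card : ℝ) ≤ 4 / η ^ 2 := by
  set B := badSet η cx cy y h a b with hB
  have hmem : ∀ i ∈ B, ∃ k p q, k ≠ i ∧ η * n < |∑ t, centred a (cx i t) *
      flag (h (cx k t) (cy p t) (cy q t)) * if y t = b then 1 else 0| := by
    intro i hi
    obtain ⟨k, hk, p, q, hpq⟩ := (Finset.mem_filter.1 hi).2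
    exact ⟨k, p, q, hk, hpq⟩
  rcases B.eq_empty_or_nonempty with h0 | ⟨i₀, hi₀⟩
  · rw [h0, Finset.card_empty, Nat.cast_zero]
    positivity
  have : Nonempty (Fin N₁) := ⟨i₀⟩
  have : Nonempty (Fin N₂) := ⟨(hmem i₀ hi₀).choose_spec.choose⟩
  choose! k p q hkpq using hmem
  have key := card_mul_sq_le hn B
    (fun i t => centred a (cx i t) * flag (h (cx (k i) t) (cy (p i) t) (cy (q i) t)))
    (fun t => if y t = b then 1 else 0) (fun t => by split_ifs <;> simp) hη.le
    (c := B.card * (η ^ 2 / 2) + 2) (by positivity)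
    (fun i hi => (hkpq i hi).2.le) fun j hj => by
      have hb : ∀ i ∈ B, |∑ t, centred a (cx i t) * flag (h (cx (k i) t) (cy (p i) t) (cy (q i) t)) *
          (centred a (cx j t) * flag (h (cx (k j) t) (cy (p j) t) (cy (q j) t)))| ≤
          η ^ 2 / 2 * n + ((if i = j then (n : ℝ) else 0) + if i = k j then (n : ℝ) else 0) := by
        intro i hi
        have hn1 : |∑ t, centred a (cx i t) * flag (h (cx (k i) t) (cy (p i) t) (cy (q i) t)) *
          (centred a (cx j t) * flag (h (cx (k j) t) (cy (p j) t) (cy (q j) t)))| ≤ n :=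
          abs_sum_le_card fun t => abs_mul_le_one
            (abs_mul_le_one (abs_centred_le _ _) (abs_flag_le _))
            (abs_mul_le_one (abs_centred_le _ _) (abs_flag_le _))
        have hη2 : 0 ≤ η ^ 2 / 2 * n := by positivity
        have hn0 : (0 : ℝ) ≤ n := n.cast_nonneg
        by_cases hij : i = j
        · rw [if_pos hij]
          split_ifs <;> linarith
        by_cases hik : i = k j
        · rw [if_neg hij, if_pos hik]
          linarith
        rw [if_neg hij, if_neg hik]
        simpa [mul_assoc] using hG i j (k i) (k j) hij (hkpq i hi).1.symm hik (p i) (q i)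
          (p j) (q j) h a
      refine (Finset.sum_le_sum hb).trans ?_
      rw [Finset.sum_add_distrib, Finset.sum_add_distrib, Finset.sum_ite_eq', Finset.sum_ite_eq',
        Finset.sum_const, nsmul_eq_mul]
      have hn0 : (0 : ℝ) ≤ n := n.cast_nonneg
      split_ifs <;> nlinarith
  rw [le_div_iff₀ (by positivity)]
  linarith

variable [Fintype Z]

/-- The probability of a large deviation of the output statistics. -/
theorem blockProb_deviation_le {X : Type*} (W : MAC X Y Z) (x : Fin n → X) (y : Fin n → Y) (g : Fin n → ℝ)
    (hg : ∀ t, |g t| ≤ 1) (c : Z) {δ : ℝ} (hδ : 0 < δ) (hδ1 : δ ≤ 1) :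
    blockProb W x y {z | δ * n < |∑ t, g t * ((if z t = c then 1 else 0) - (W (x t) (y t)).1 c)|} ≤
      2 * Real.exp (-(n * δ ^ 2 / 4)) := by
  have h := tail_le (p := fun t => (W (x t) (y t)).1)
    (F := fun t z => g t * ((if z = c then 1 else 0) - (W (x t) (y t)).1 c))
    (fun t => (W (x t) (y t)).2.1) (fun t => (W (x t) (y t)).2.2)
    (fun t z => abs_mul_le_one (hg t) ?_) (fun t => ?_) hδ hδ1
  · exact h
  · have h1 := (W (x t) (y t)).2.1 c
    have h2 : (W (x t) (y t)).1 c ≤ 1 := by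
      rw [← (W (x t) (y t)).2.2]
      exact Finset.single_le_sum (fun z _ => (W (x t) (y t)).2.1 z) (Finset.mem_univ c)
    rw [abs_le]
    split_ifs <;> constructor <;> linarith
  · have h1 := (W (x t) (y t)).2.2
    simp_rw [mul_left_comm _ (g t), ← Finset.mul_sum, mul_sub, Finset.sum_sub_distrib,
      ← Finset.sum_mul]
    rw [h1]
    simp

variable [Fintype Y]

theorem blockProb_not_accepts_le [Nonempty X] (W : MAC X Y Z) {η : ℝ} (hη : 0 < η) (hη1 : η ≤ 1)
    (cx : Fin N₁ → Fin n → X) (cy : Fin N₂ → Fin n → Y) (y : Fin n → Y) (i : Fin N₁)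
    (hi : ∀ h a b, i ∉ badSet (η / 2) cx cy y h a b) :
    blockProb W (cx i) y {z | ¬ Accepts W η cx cy z i} ≤
      Fintype.card (Fin N₁ × Fin N₂ × Fin N₂ × (X → Y → Y → Bool) × X × Y × Z) *
        (2 * Real.exp (-(n * (η / 2) ^ 2 / 4))) := by
  set g : Fin N₁ × Fin N₂ × Fin N₂ × (X → Y → Y → Bool) × X × Y × Z → Fin n → ℝ :=
    fun J t => if (J.2.2.2.1 (cx J.1 t) (cy J.2.1 t) (cy J.2.2.1 t) = true ∧
      y t = J.2.2.2.2.2.1) ∧ cx i t = J.2.2.2.2.1 then 1 else 0 with hg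
  have hsub : {z | ¬ Accepts W η cx cy z i} ⊆ ⋃ J, {z | η / 2 * n < |∑ t, g J t *
      ((if z t = J.2.2.2.2.2.2 then 1 else 0) - (W (cx i t) (y t)).1 J.2.2.2.2.2.2)|} := by
    intro z hz
    simp only [Set.mem_ofPred_eq, Accepts] at hz
    push Not at hz
    obtain ⟨k, hk, p, q, h, a, b, c, hlt⟩ := hz y
    refine Set.mem_iUnion.2 ⟨(k, p, q, h, a, b, c), ?_⟩
    have hib := hi h a b
    simp only [badSet, Finset.mem_filter, Finset.mem_univ, true_and] at hib
    push Not at hib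
    have hib' := hib k hk p q
    have hW0 := (W a b).2.1 c
    have hW1 : (W a b).1 c ≤ 1 := by
      rw [← (W a b).2.2]
      exact Finset.single_le_sum (fun z _ => (W a b).2.1 z) (Finset.mem_univ c)
    have hdec : ∑ t, (if h (cx k t) (cy p t) (cy q t) = true ∧ y t = b then (1 : ℝ) else 0) *
        ((if cx i t = a ∧ z t = c then 1 else 0) - (W a b).1 c / Fintype.card X) =
        ∑ t, g (k, p, q, h, a, b, c) t * ((if z t = c then 1 else 0) - (W (cx i t) (y t)).1 c) +
        (W a b).1 c * ∑ t, centred a (cx i t) *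
          flag (h (cx k t) (cy p t) (cy q t)) * if y t = b then 1 else 0 := by
      rw [Finset.mul_sum, ← Finset.sum_add_distrib]
      refine Finset.sum_congr rfl fun t _ => ?_
      simp only [hg, centred, flag]
      by_cases h1 : h (cx k t) (cy p t) (cy q t) = true <;> by_cases h2 : y t = b <;>
        by_cases h3 : cx i t = a <;> simp [h1, h2, h3] <;> ring
    rw [hdec] at hlt
    have h1 := hlt.trans_le (abs_add_le _ _)
    rw [abs_mul, abs_of_nonneg hW0] at h1
    have h2 := mul_le_of_le_one_left (abs_nonneg (∑ t, centred a (cx i t) *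
      flag (h (cx k t) (cy p t) (cy q t)) * if y t = b then (1 : ℝ) else 0)) hW1
    change η / 2 * n < _
    linarith
  refine (blockProb_mono W _ _ hsub).trans ((blockProb_iUnion_le W _ _ _).trans ?_)
  refine (Finset.sum_le_sum fun J _ => blockProb_deviation_le W (cx i) y (g J) (fun t => ?_)
    J.2.2.2.2.2.2 (half_pos hη) (by linarith)).trans_eq ?_
  · simp only [hg]
    split_ifs <;> simp
  · rw [Finset.sum_const, Finset.card_univ, nsmul_eq_mul]

/-- Whatever user 2 sends, most messages of user 1 are accepted with high probability. -/
theorem sum_blockProb_not_accepts_le [Nonempty X] (W : MAC X Y Z) (hn : 0 < n) {η : ℝ}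
    (hη : 0 < η) (hη1 : η ≤ 1) {cx : Fin N₁ → Fin n → X} {cy : Fin N₂ → Fin n → Y}
    (hG : GoodBook (η ^ 2 / 8) cx cy) (y : Fin n → Y) :
    ∑ i, blockProb W (cx i) y {z | ¬ Accepts W η cx cy z i} ≤
      Fintype.card ((X → Y → Y → Bool) × X × Y) * (16 / η ^ 2) +
      N₁ * (Fintype.card (Fin N₁ × Fin N₂ × Fin N₂ × (X → Y → Y → Bool) × X × Y × Z) *
        (2 * Real.exp (-(n * (η / 2) ^ 2 / 4)))) := by
  have hG' : GoodBook ((η / 2) ^ 2 / 2) cx cy := by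
    convert hG using 1
    ring
  set r : ℝ := Fintype.card (Fin N₁ × Fin N₂ × Fin N₂ × (X → Y → Y → Bool) × X × Y × Z) *
        (2 * Real.exp (-(n * (η / 2) ^ 2 / 4))) with hr
  have hr0 : 0 ≤ r := by positivity
  have hpt : ∀ i, blockProb W (cx i) y {z | ¬ Accepts W η cx cy z i} ≤
      ∑ J : (X → Y → Y → Bool) × X × Y,
        (if i ∈ badSet (η / 2) cx cy y J.1 J.2.1 J.2.2 then (1 : ℝ) else 0) + r := by
    intro i
    by_cases hi : ∀ h a b, i ∉ badSet (η / 2) cx cy y h a b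
    · refine (blockProb_not_accepts_le W hη hη1 cx cy y i hi).trans (le_add_of_nonneg_left ?_)
      exact Finset.sum_nonneg fun J _ => by split_ifs <;> simp
    · push Not at hi
      obtain ⟨h, a, b, hi⟩ := hi
      refine (blockProb_le_one _ _ _ _).trans (le_add_of_le_of_nonneg ?_ hr0)
      refine le_trans (le_of_eq ?_) (Finset.single_le_sum
        (f := fun J : (X → Y → Y → Bool) × X × Y =>
          if i ∈ badSet (η / 2) cx cy y J.1 J.2.1 J.2.2 then (1 : ℝ) else 0)
        (fun J _ => by split_ifs <;> simp) (Finset.mem_univ (h, a, b)))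
      rw [if_pos hi]
  refine (Finset.sum_le_sum fun i _ => hpt i).trans ?_
  rw [Finset.sum_add_distrib, Finset.sum_comm]
  refine add_le_add ?_ (by simp)
  refine (Finset.sum_le_sum fun J _ => ?_ : _ ≤ ∑ _J : (X → Y → Y → Bool) × X × Y,
    16 / η ^ 2).trans_eq (by rw [Finset.sum_const, Finset.card_univ, nsmul_eq_mul])
  have h := hG'.card_badSet_le hn (half_pos hη) y J.1 J.2.1 J.2.2
  rw [Finset.sum_ite_mem, Finset.univ_inter, Finset.sum_const, nsmul_eq_mul, mul_one]
  refine h.trans_eq ?_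
  field_simp
  norm_num

end Codebooks

end ByzantineMAC

namespace ByzantineMAC

section RandomCodebooks

open scoped Classical

/-- Resampling one coordinate does not change an average over all functions. -/
theorem sum_le_of_sum_update_le {ι A : Type*} [Fintype ι] [DecidableEq ι] [Fintype A] [Nonempty A] (i : ι)
    (F : (ι → A) → ℝ) {r : ℝ}
    (h : ∀ c, ∑ v, F (Function.update c i v) ≤ Fintype.card A * r) :
    ∑ c, F c ≤ Fintype.card (ι → A) * r := by
  have hinv : Function.Involutive
      (fun cv : (ι → A) × A => (Function.update cv.1 i cv.2, cv.1 i)) := fun cv => by simp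
  have hsum : ∑ c, ∑ v, F (Function.update c i v) = Fintype.card A * ∑ c, F c := by
    rw [← Fintype.sum_prod_type' (fun c v => F (Function.update c i v)),
      ← Equiv.sum_comp hinv.toPerm]
    simp [Fintype.sum_prod_type, Finset.mul_sum]
  have hA : (0 : ℝ) < Fintype.card A := by exact_mod_cast Fintype.card_pos
  have h1 := Finset.sum_le_sum fun c (_ : c ∈ Finset.univ) => h c
  rw [hsum, Finset.sum_const, Finset.card_univ, nsmul_eq_mul] at h1
  refine le_of_mul_le_mul_left (h1.trans_eq ?_) hA
  ring

variable {X Y : Type*} [Fintype X] [Nonempty X] {N₁ N₂ n : ℕ}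

theorem sum_centred (a : X) : ∑ x, centred a x = 0 := by
  have hX : (Fintype.card X : ℝ) ≠ 0 := by exact_mod_cast Fintype.card_ne_zero
  simp [centred, hX]

/-- The number of uniformly chosen sequences correlated with a given vector. -/
theorem card_correlated_le (a : X) (g : Fin n → ℝ) (hg : ∀ t, |g t| ≤ 1) {δ : ℝ} (hδ : 0 < δ)
    (hδ1 : δ ≤ 1) :
    ∑ x : Fin n → X, (if δ * n < |∑ t, centred a (x t) * g t| then (1 : ℝ) else 0) ≤
      Fintype.card (Fin n → X) * (2 * Real.exp (-(n * δ ^ 2 / 4))) := by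
  have hX : (0 : ℝ) < Fintype.card X := by exact_mod_cast Fintype.card_pos
  have h := tail_le (n := n) (p := fun _ (_ : X) => 1 / (Fintype.card X : ℝ))
    (F := fun t x => centred a x * g t) (fun _ _ => by positivity)
    (fun _ => by simp)
    (fun t x => abs_mul_le_one (abs_centred_le _ _) (hg t))
    (fun t => by rw [← Finset.mul_sum, ← Finset.sum_mul, sum_centred]; simp) hδ hδ1
  simp only [Finset.prod_const, Finset.card_univ, Fintype.card_fin] at h
  rw [Fintype.card_fun, Fintype.card_fin, Nat.cast_pow, ← div_le_iff₀' (by positivity),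
    Finset.sum_div]
  refine le_trans (Finset.sum_le_sum fun x _ => ?_) h
  split_ifs <;> simp

/-- Most codebooks of user 1 are pseudorandom relative to a given codebook of user 2. -/
theorem card_not_goodBook_le [Fintype Y] {δ : ℝ} (hδ : 0 < δ) (hδ1 : δ ≤ 1)
    (cy : Fin N₂ → Fin n → Y) :
    ∑ cx : Fin N₁ → Fin n → X, (if GoodBook δ cx cy then (0 : ℝ) else 1) ≤
      Fintype.card (Fin N₁ → Fin n → X) * (Fintype.card ((Fin N₁ × Fin N₁ × Fin N₁ × Fin N₁) ×
        (Fin N₂ × Fin N₂ × Fin N₂ × Fin N₂) × (X → Y → Y → Bool) × X) *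
        (2 * Real.exp (-(n * δ ^ 2 / 4)))) := by
  set r := 2 * Real.exp (-(n * δ ^ 2 / 4)) with hr
  set g : ((Fin N₁ × Fin N₁ × Fin N₁ × Fin N₁) × (Fin N₂ × Fin N₂ × Fin N₂ × Fin N₂) ×
      (X → Y → Y → Bool) × X) → (Fin N₁ → Fin n → X) → Fin n → ℝ :=
    fun ⟨⟨_, j, k, l⟩, ⟨p, q, p', q'⟩, h, a⟩ cx t => flag (h (cx k t) (cy p t) (cy q t)) *
      (centred a (cx j t) * flag (h (cx l t) (cy p' t) (cy q' t))) with hg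
  set F : ((Fin N₁ × Fin N₁ × Fin N₁ × Fin N₁) × (Fin N₂ × Fin N₂ × Fin N₂ × Fin N₂) ×
      (X → Y → Y → Bool) × X) → (Fin N₁ → Fin n → X) → ℝ :=
    fun J cx => if (J.1.1 ≠ J.1.2.1 ∧ J.1.1 ≠ J.1.2.2.1 ∧ J.1.1 ≠ J.1.2.2.2) ∧
      δ * n < |∑ t, centred J.2.2.2 (cx J.1.1 t) * g J cx t| then 1 else 0 with hF
  have hF0 : ∀ J cx, 0 ≤ F J cx := fun J cx => by
    simp only [hF]
    split_ifs <;> simp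
  have hpt : ∀ cx : Fin N₁ → Fin n → X, (if GoodBook δ cx cy then (0 : ℝ) else 1) ≤
      ∑ J, F J cx := by
    intro cx
    split_ifs with hG
    · exact Finset.sum_nonneg fun J _ => hF0 J cx
    · unfold GoodBook at hG
      push Not at hG
      obtain ⟨i, j, k, l, hj, hk, hl, p, q, p', q', h, a, hlt⟩ := hG
      refine le_trans (le_of_eq ?_) (Finset.single_le_sum (fun J _ => hF0 J cx)
        (Finset.mem_univ ((i, j, k, l), (p, q, p', q'), h, a)))
      simp only [hF]
      rw [if_pos ⟨⟨hj, hk, hl⟩, hlt⟩]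
  have hJ : ∀ J, ∑ cx, F J cx ≤ Fintype.card (Fin N₁ → Fin n → X) * r := by
    intro J
    refine sum_le_of_sum_update_le J.1.1 (F J) fun cx => ?_
    have hg1 : ∀ t, |g J cx t| ≤ 1 := fun t =>
      abs_mul_le_one (abs_flag_le _) (abs_mul_le_one (abs_centred_le _ _) (abs_flag_le _))
    refine le_trans (Finset.sum_le_sum fun v _ => ?_)
      (card_correlated_le J.2.2.2 (g J cx) hg1 hδ hδ1)
    obtain ⟨⟨i, j, k, l⟩, ⟨p, q, p', q'⟩, h, a⟩ := J
    simp only [hF, hg]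
    by_cases hd : i ≠ j ∧ i ≠ k ∧ i ≠ l
    · simp [hd, Function.update_of_ne hd.1.symm, Function.update_of_ne hd.2.1.symm,
        Function.update_of_ne hd.2.2.symm]
    · rw [if_neg fun h => hd h.1]
      split_ifs <;> simp
  refine (Finset.sum_le_sum fun cx _ => hpt cx).trans ?_
  rw [Finset.sum_comm]
  refine (Finset.sum_le_sum fun J _ => hJ J).trans_eq ?_
  rw [Finset.sum_const, Finset.card_univ, nsmul_eq_mul]
  ring

theorem exists_goodBook [Fintype Y] [Nonempty Y] {δ : ℝ} (hδ : 0 < δ) (hδ1 : δ ≤ 1)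
    (hlt : Fintype.card ((Fin N₁ × Fin N₁ × Fin N₁ × Fin N₁) ×
        (Fin N₂ × Fin N₂ × Fin N₂ × Fin N₂) × (X → Y → Y → Bool) × X) *
          (2 * Real.exp (-(n * δ ^ 2 / 4))) +
      Fintype.card ((Fin N₂ × Fin N₂ × Fin N₂ × Fin N₂) ×
        (Fin N₁ × Fin N₁ × Fin N₁ × Fin N₁) × (Y → X → X → Bool) × Y) *
          (2 * Real.exp (-(n * δ ^ 2 / 4))) < 1) :
    ∃ (cx : Fin N₁ → Fin n → X) (cy : Fin N₂ → Fin n → Y),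
      GoodBook δ cx cy ∧ GoodBook δ cy cx := by
  by_contra! hc
  have h1 : (Fintype.card (Fin N₁ → Fin n → X) : ℝ) * Fintype.card (Fin N₂ → Fin n → Y) ≤
      ∑ cy : Fin N₂ → Fin n → Y, ∑ cx : Fin N₁ → Fin n → X,
        (if GoodBook δ cx cy then (0 : ℝ) else 1) +
      ∑ cx : Fin N₁ → Fin n → X, ∑ cy : Fin N₂ → Fin n → Y,
        (if GoodBook δ cy cx then (0 : ℝ) else 1) := by
    rw [Finset.sum_comm, ← Finset.sum_add_distrib]
    simp_rw [← Finset.sum_add_distrib]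
    calc (Fintype.card (Fin N₁ → Fin n → X) : ℝ) * Fintype.card (Fin N₂ → Fin n → Y)
        = ∑ _cx : Fin N₁ → Fin n → X, ∑ _cy : Fin N₂ → Fin n → Y, (1 : ℝ) := by
          simp only [Finset.sum_const, Finset.card_univ, nsmul_eq_mul, mul_one]
      _ ≤ _ := Finset.sum_le_sum fun cx _ => Finset.sum_le_sum fun cy _ => by
          have := hc cx cy
          by_cases h : GoodBook δ cx cy
          · simp [h, this h]
          · rw [if_neg h]
            split_ifs <;> simp
  have h2 := Finset.sum_le_sum fun cy (_ : cy ∈ (Finset.univ : Finset (Fin N₂ → Fin n → Y))) =>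
    card_not_goodBook_le (X := X) (N₁ := N₁) hδ hδ1 cy
  have h3 := Finset.sum_le_sum fun cx (_ : cx ∈ (Finset.univ : Finset (Fin N₁ → Fin n → X))) =>
    card_not_goodBook_le (X := Y) (N₁ := N₂) hδ hδ1 cx
  rw [Finset.sum_const, Finset.card_univ, nsmul_eq_mul] at h2 h3
  have hU : (0 : ℝ) < Fintype.card (Fin N₁ → Fin n → X) := by exact_mod_cast Fintype.card_pos
  have hV : (0 : ℝ) < Fintype.card (Fin N₂ → Fin n → Y) := by exact_mod_cast Fintype.card_pos
  nlinarith [mul_pos hU hV, mul_lt_mul_of_pos_left hlt (mul_pos hU hV)]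

end RandomCodebooks

end ByzantineMAC

namespace ByzantineMAC

section Swap

variable {X Y Z : Type*} {N₁ N₂ n : ℕ}

/-- The decoder output with the two users exchanged. -/
def Output.swap : Output N₁ N₂ → Output N₂ N₁
  | .messages m₁ m₂ => .messages m₂ m₁
  | .blame₁ => .blame₂
  | .blame₂ => .blame₁

/-- The code with the two users exchanged. -/
def Code.swap (c : Code X Y Z N₁ N₂ n) : Code Y X Z N₂ N₁ n where
  enc₁ := c.enc₂
  enc₂ := c.enc₁
  dec z := (c.dec z).swap

theorem Code.swap_errNone (c : Code X Y Z N₁ N₂ n) (m₁ : Fin N₁) (m₂ : Fin N₂) :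
    c.swap.errNone m₂ m₁ = c.errNone m₁ m₂ := by
  ext z
  simp only [Code.errNone, Code.swap, Set.mem_ofPred_eq]
  cases c.dec z <;> simp [Output.swap, and_comm]

theorem Code.swap_errAdv₁ (c : Code X Y Z N₁ N₂ n) (m₁ : Fin N₁) :
    c.swap.errAdv₁ m₁ = c.errAdv₂ m₁ := by
  ext z
  simp only [Code.errAdv₁, Code.errAdv₂, Code.swap, Set.mem_ofPred_eq]
  cases c.dec z <;> simp [Output.swap]

theorem Code.swap_errAdv₂ (c : Code X Y Z N₁ N₂ n) (m₂ : Fin N₂) :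
    c.swap.errAdv₂ m₂ = c.errAdv₁ m₂ := by
  ext z
  simp only [Code.errAdv₁, Code.errAdv₂, Code.swap, Set.mem_ofPred_eq]
  cases c.dec z <;> simp [Output.swap]

theorem probErr_swap [Fintype Z] (W : MAC X Y Z) (c : Code X Y Z N₁ N₂ n) :
    probErr (swap W) c.swap = probErr W c := by
  have h0 : probErrNone (swap W) c.swap = probErrNone W c := by
    unfold probErrNone
    rw [Finset.sum_comm, mul_comm (N₂ : ℝ)]
    simp_rw [Code.swap_errNone]
    rfl
  have h1 : probErrAdv₁ (swap W) c.swap = probErrAdv₂ W c := by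
    unfold probErrAdv₁ probErrAdv₂
    simp_rw [Code.swap_errAdv₁]
    rfl
  have h2 : probErrAdv₂ (swap W) c.swap = probErrAdv₁ W c := by
    unfold probErrAdv₁ probErrAdv₂
    simp_rw [Code.swap_errAdv₂]
    rfl
  rw [probErr, probErr, h0, h1, h2, max_comm (probErrAdv₂ W c)]

theorem Achievable.swap [Fintype Z] {W : MAC X Y Z} {R : ℝ × ℝ} (h : Achievable W R) :
    Achievable (swap W) R.swap := by
  obtain ⟨h1, h2, c, hc⟩ := h
  exact ⟨h2, h1, fun n => (c n).swap, by simpa only [probErr_swap] using hc⟩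

theorem Spoofable₂.swap [Fintype X] [Fintype Y] [Fintype Z] {W : MAC X Y Z}
    (h : Spoofable₂ W) : Spoofable₁ (swap W) := by
  obtain ⟨Q, Q', h⟩ := h
  exact ⟨fun y x => Q x y, Q', fun y' y x z => h x y y' z⟩

theorem Spoofable₂.of_swap [Fintype X] [Fintype Y] [Fintype Z] {W : MAC X Y Z}
    (h : Spoofable₁ (ByzantineMAC.swap W)) : Spoofable₂ W := by
  obtain ⟨Q, Q', h⟩ := h
  exact ⟨fun x y => Q y x, Q', fun x y y' z => h y' y x z⟩

end Swap

section EmptyInterior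

variable {X Y Z : Type*} [Fintype X] [Fintype Y] [Fintype Z]

theorem tendsto_floor_rpow {R : ℝ} (hR : 0 < R) :
    Tendsto (fun n : ℕ => ⌊(2 : ℝ) ^ ((n : ℝ) * R)⌋₊) atTop atTop :=
  tendsto_nat_floor_atTop.comp <| (tendsto_rpow_atTop_of_base_gt_one 2 one_lt_two).comp <|
    tendsto_natCast_atTop_atTop.atTop_mul_const hR

theorem floor_rpow_pos {R : ℝ} (hR : 0 ≤ R) (n : ℕ) : 0 < ⌊(2 : ℝ) ^ ((n : ℝ) * R)⌋₊ :=
  Nat.floor_pos.2 (Real.one_le_rpow one_le_two (by positivity))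

theorem Spoofable₁.rate_eq_zero {W : MAC X Y Z} (hW : Spoofable₁ W) {R : ℝ × ℝ}
    (h : Achievable W R) : R.1 = 0 := by
  obtain ⟨h1, h2, c, hc⟩ := h
  refine le_antisymm (not_lt.1 fun hpos => ?_) h1
  obtain ⟨n, hn, hn'⟩ := ((hc.eventually (gt_mem_nhds (by norm_num : (0 : ℝ) < 1 / 6))).and
    ((tendsto_floor_rpow hpos).eventually_ge_atTop 2)).exists
  exact hn.not_ge (hW.probErr_lower_bound (c n) hn' (floor_rpow_pos h2 n))

theorem Spoofable.interior_capacityRegion {W : MAC X Y Z} (hW : Spoofable W) :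
    interior (capacityRegion W) = ∅ := by
  have hsub : ∀ f : ℝ × ℝ → ℝ, Continuous f → IsOpenMap f →
      (∀ R, Achievable W R → f R = 0) → interior (capacityRegion W) = ∅ := by
    intro f hf hfo h
    have h1 : capacityRegion W ⊆ f ⁻¹' {0} :=
      closure_minimal (fun R hR => h R hR) (isClosed_singleton.preimage hf)
    refine Set.subset_eq_empty (interior_mono h1) ?_
    rw [← hfo.preimage_interior_eq_interior_preimage hf, interior_singleton, Set.preimage_empty]
  rcases hW with hW | hW
  · exact hsub Prod.fst continuous_fst isOpenMap_fst fun R hR => hW.rate_eq_zero hR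
  · exact hsub Prod.snd continuous_snd isOpenMap_snd fun R hR => hW.swap.rate_eq_zero hR.swap

end EmptyInterior

section Achievability

open scoped Classical

variable {X Y Z : Type*} [Fintype Z] {N₁ N₂ n : ℕ}

theorem probErr_nonneg (W : MAC X Y Z) (c : Code X Y Z N₁ N₂ n) : 0 ≤ probErr W c := by
  refine le_trans ?_ (le_max_left _ _)
  exact mul_nonneg (by positivity) (Finset.sum_nonneg fun i _ =>
    Finset.sum_nonneg fun j _ => blockProb_nonneg _ _ _ _)

/-- Decode the accepted pair if both users have accepted messages, and otherwise blame a user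
without accepted messages. -/
noncomputable def acceptDecoder (A₁ : (Fin n → Z) → Fin N₁ → Prop)
    (A₂ : (Fin n → Z) → Fin N₂ → Prop) (z : Fin n → Z) : Output N₁ N₂ :=
  if h : (∃ i, A₁ z i) ∧ ∃ j, A₂ z j then .messages h.1.choose h.2.choose
  else if ∃ i, A₁ z i then .blame₂ else .blame₁

/-- Uniqueness of accepted messages makes every error of the code the rejection of an honest
message. -/
theorem probErr_acceptDecoder_le [Nonempty X] [Nonempty Y] (W : MAC X Y Z) (hN₁ : 0 < N₁)
    (hN₂ : 0 < N₂) (cx : Fin N₁ → Fin n → X) (cy : Fin N₂ → Fin n → Y)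
    (A₁ : (Fin n → Z) → Fin N₁ → Prop) (A₂ : (Fin n → Z) → Fin N₂ → Prop)
    (hA₁ : ∀ z i j p, A₁ z i → A₁ z j → A₂ z p → i = j)
    (hA₂ : ∀ z p q i, A₂ z p → A₂ z q → A₁ z i → p = q) {r₁ r₂ : ℝ}
    (h₁ : ∀ y, ∑ i, blockProb W (cx i) y {z | ¬ A₁ z i} ≤ N₁ * r₁)
    (h₂ : ∀ x, ∑ p, blockProb W x (cy p) {z | ¬ A₂ z p} ≤ N₂ * r₂) :
    probErr W ⟨cx, cy, acceptDecoder A₁ A₂⟩ ≤ r₁ + r₂ := by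
  have hN₁' : (0 : ℝ) < N₁ := by exact_mod_cast hN₁
  have hN₂' : (0 : ℝ) < N₂ := by exact_mod_cast hN₂
  have hdec : ∀ z i p, A₁ z i → A₂ z p → acceptDecoder A₁ A₂ z = .messages i p := by
    intro z i p hi hp
    have h : (∃ i, A₁ z i) ∧ ∃ j, A₂ z j := ⟨⟨i, hi⟩, ⟨p, hp⟩⟩
    rw [acceptDecoder, dif_pos h, hA₁ z _ i p h.1.choose_spec hi hp,
      hA₂ z _ p i h.2.choose_spec hp hi]
  set c : Code X Y Z N₁ N₂ n := ⟨cx, cy, acceptDecoder A₁ A₂⟩ with hc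
  have hadv₂ : ∀ i, c.errAdv₂ i ⊆ {z | ¬ A₁ z i} := by
    intro i z hz hi
    refine hz ?_
    by_cases h : ∃ p, A₂ z p
    · obtain ⟨p, hp⟩ := h
      exact Or.inl ⟨p, hdec z i p hi hp⟩
    · refine Or.inr ?_
      change acceptDecoder A₁ A₂ z = _
      rw [acceptDecoder, dif_neg (fun h' => h h'.2), if_pos ⟨i, hi⟩]
  have hadv₁ : ∀ p, c.errAdv₁ p ⊆ {z | ¬ A₂ z p} := by
    intro p z hz hp
    refine hz ?_
    by_cases h : ∃ i, A₁ z i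
    · obtain ⟨i, hi⟩ := h
      exact Or.inl ⟨i, hdec z i p hi hp⟩
    · refine Or.inr ?_
      change acceptDecoder A₁ A₂ z = _
      rw [acceptDecoder, dif_neg (fun h' => h h'.1), if_neg h]
  have hnone : ∀ i p, c.errNone i p ⊆ {z | ¬ A₁ z i} ∪ {z | ¬ A₂ z p} := by
    intro i p z hz
    by_contra h
    rw [Set.mem_union, not_or] at h
    exact hz (hdec z i p (not_not.1 h.1) (not_not.1 h.2))
  have hr₁ : 0 ≤ r₁ := by
    have h := (Finset.sum_nonneg fun i _ => blockProb_nonneg W (cx i)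
      (fun _ => Classical.arbitrary Y) {z | ¬ A₁ z i}).trans (h₁ fun _ => Classical.arbitrary Y)
    exact nonneg_of_mul_nonneg_right h hN₁'
  have hr₂ : 0 ≤ r₂ := by
    have h := (Finset.sum_nonneg fun p _ => blockProb_nonneg W (fun _ => Classical.arbitrary X)
      (cy p) {z | ¬ A₂ z p}).trans (h₂ fun _ => Classical.arbitrary X)
    exact nonneg_of_mul_nonneg_right h hN₂'
  refine max_le ?_ (max_le ?_ ?_)
  · rw [probErrNone, one_div, inv_mul_le_iff₀ (by positivity)]
    calc ∑ i, ∑ p, blockProb W (cx i) (cy p) (c.errNone i p)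
        ≤ ∑ i, ∑ p, (blockProb W (cx i) (cy p) {z | ¬ A₁ z i} +
            blockProb W (cx i) (cy p) {z | ¬ A₂ z p}) :=
          Finset.sum_le_sum fun i _ => Finset.sum_le_sum fun p _ =>
            (blockProb_mono W _ _ (hnone i p)).trans (blockProb_union_le W _ _ _ _)
      _ = ∑ p, ∑ i, blockProb W (cx i) (cy p) {z | ¬ A₁ z i} +
            ∑ i, ∑ p, blockProb W (cx i) (cy p) {z | ¬ A₂ z p} := by
          simp_rw [Finset.sum_add_distrib]
          rw [Finset.sum_comm]
      _ ≤ ∑ _p : Fin N₂, N₁ * r₁ + ∑ _i : Fin N₁, N₂ * r₂ :=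
          add_le_add (Finset.sum_le_sum fun p _ => h₁ _) (Finset.sum_le_sum fun i _ => h₂ _)
      _ = N₁ * N₂ * (r₁ + r₂) := by
          simp
          ring
  · refine ciSup_le fun x => ?_
    rw [one_div, inv_mul_le_iff₀ hN₂']
    refine (Finset.sum_le_sum fun p _ => blockProb_mono W _ _ (hadv₁ p)).trans ((h₂ x).trans ?_)
    gcongr
    linarith
  · refine ciSup_le fun y => ?_
    rw [one_div, inv_mul_le_iff₀ hN₁']
    refine (Finset.sum_le_sum fun i _ => blockProb_mono W _ _ (hadv₂ i)).trans ((h₁ y).trans ?_)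
    gcongr
    linarith

theorem floor_rpow_le_exp {R ε : ℝ} (h : Real.log 2 * R ≤ ε) (n : ℕ) :
    (⌊(2 : ℝ) ^ ((n : ℝ) * R)⌋₊ : ℝ) ≤ Real.exp (n * ε) := by
  refine (Nat.floor_le (by positivity)).trans ?_
  rw [Real.rpow_def_of_pos two_pos]
  refine Real.exp_le_exp.2 ?_
  calc Real.log 2 * (n * R) = n * (Real.log 2 * R) := by ring
    _ ≤ n * ε := by gcongr

variable [Fintype X] [Fintype Y]

/-- The bound on the probability that an honest message of one user is rejected. -/
noncomputable def rejectBound (X Y Z : Type*) [Fintype X] [Fintype Y] [Fintype Z] (η : ℝ)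
    (N n : ℕ) : ℝ :=
  Fintype.card ((X → Y → Y → Bool) × X × Y) * (16 / η ^ 2) / N +
    Fintype.card ((X → Y → Y → Bool) × X × Y × Z) * 2 * Real.exp (-(η ^ 2 / 32) * n)

theorem tendsto_exp_neg_mul {a : ℝ} (ha : 0 < a) :
    Tendsto (fun n : ℕ => Real.exp (-a * n)) atTop (𝓝 0) :=
  Real.tendsto_exp_atBot.comp <|
    tendsto_natCast_atTop_atTop.const_mul_atTop_of_neg (neg_neg_of_pos ha)

theorem tendsto_rejectBound {η : ℝ} (hη : 0 < η) {R : ℝ} (hR : 0 < R) :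
    Tendsto (fun n : ℕ => rejectBound X Y Z η ⌊(2 : ℝ) ^ ((n : ℝ) * R)⌋₊ n) atTop (𝓝 0) := by
  have h1 : Tendsto (fun n : ℕ => (Fintype.card ((X → Y → Y → Bool) × X × Y) * (16 / η ^ 2)) /
      (⌊(2 : ℝ) ^ ((n : ℝ) * R)⌋₊ : ℝ)) atTop (𝓝 0) :=
    tendsto_const_nhds.div_atTop (tendsto_natCast_atTop_atTop.comp (tendsto_floor_rpow hR))
  have h2 := (tendsto_exp_neg_mul (by positivity : 0 < η ^ 2 / 32)).const_mul
    (Fintype.card ((X → Y → Y → Bool) × X × Y × Z) * 2 : ℝ)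
  simpa [rejectBound] using h1.add h2

theorem sum_blockProb_not_accepts_le_rejectBound [Nonempty X] (W : MAC X Y Z) (hn : 0 < n) {η : ℝ}
    (hη : 0 < η) (hη1 : η ≤ 1) (hN₁ : 0 < N₁) (hN₁' : (N₁ : ℝ) ≤ Real.exp (n * (η ^ 4 / 4096)))
    (hN₂' : (N₂ : ℝ) ≤ Real.exp (n * (η ^ 4 / 4096))) {cx : Fin N₁ → Fin n → X}
    {cy : Fin N₂ → Fin n → Y} (hG : GoodBook (η ^ 2 / 8) cx cy) (y : Fin n → Y) :
    ∑ i, blockProb W (cx i) y {z | ¬ Accepts W η cx cy z i} ≤ N₁ * rejectBound X Y Z η N₁ n := by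
  refine (sum_blockProb_not_accepts_le W hn hη hη1 hG y).trans ?_
  have hN : (0 : ℝ) < N₁ := by exact_mod_cast hN₁
  have e : (N₁ * (N₂ * N₂) : ℝ) * Real.exp (-(n * (η / 2) ^ 2 / 4)) ≤
      Real.exp (-(η ^ 2 / 32) * n) := by
    calc (N₁ * (N₂ * N₂) : ℝ) * Real.exp (-(n * (η / 2) ^ 2 / 4))
        ≤ Real.exp (n * (η ^ 4 / 4096)) * (Real.exp (n * (η ^ 4 / 4096)) *
            Real.exp (n * (η ^ 4 / 4096))) * Real.exp (-(n * (η / 2) ^ 2 / 4)) := by gcongr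
      _ = Real.exp (n * (η ^ 4 / 4096) + (n * (η ^ 4 / 4096) + n * (η ^ 4 / 4096)) +
            -(n * (η / 2) ^ 2 / 4)) := by simp only [Real.exp_add]
      _ ≤ Real.exp (-(η ^ 2 / 32) * n) := by
          refine Real.exp_le_exp.2 ?_
          have h1 : η ^ 4 ≤ η ^ 2 := pow_le_pow_of_le_one hη.le hη1 (by norm_num)
          have h2 : (0 : ℝ) ≤ n := n.cast_nonneg
          nlinarith [mul_le_mul_of_nonneg_left h1 h2, mul_nonneg h2 (sq_nonneg η)]
  rw [rejectBound, mul_add, mul_div_cancel₀ _ hN.ne']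
  refine add_le_add le_rfl (mul_le_mul_of_nonneg_left ?_ hN.le)
  rw [Fintype.card_prod, Fintype.card_prod, Fintype.card_prod (Fin N₂)]
  simp only [Fintype.card_fin]
  push_cast
  calc _ = (Fintype.card ((X → Y → Y → Bool) × X × Y × Z) * 2 : ℝ) *
        ((N₁ * (N₂ * N₂) : ℝ) * Real.exp (-(n * (η / 2) ^ 2 / 4))) := by ring
    _ ≤ _ := by gcongr

theorem card_mul_exp_le {η : ℝ} (hN₁ : (N₁ : ℝ) ≤ Real.exp (n * (η ^ 4 / 4096)))
    (hN₂ : (N₂ : ℝ) ≤ Real.exp (n * (η ^ 4 / 4096))) (L : Type*) [Fintype L] :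
    Fintype.card ((Fin N₁ × Fin N₁ × Fin N₁ × Fin N₁) ×
        (Fin N₂ × Fin N₂ × Fin N₂ × Fin N₂) × L) *
          (2 * Real.exp (-(n * (η ^ 2 / 8) ^ 2 / 4))) ≤
      Fintype.card L * 2 * Real.exp (-(η ^ 4 / 512) * n) := by
  simp only [Fintype.card_prod, Fintype.card_fin]
  push_cast
  calc _ = (Fintype.card L * 2 : ℝ) * ((N₁ ^ 4 * N₂ ^ 4 : ℝ) *
        Real.exp (-(n * (η ^ 2 / 8) ^ 2 / 4))) := by ring
    _ ≤ (Fintype.card L * 2 : ℝ) * ((Real.exp (n * (η ^ 4 / 4096)) ^ 4 *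
        Real.exp (n * (η ^ 4 / 4096)) ^ 4) * Real.exp (-(n * (η ^ 2 / 8) ^ 2 / 4))) := by gcongr
    _ = _ := by
        rw [← Real.exp_nat_mul, ← Real.exp_add, ← Real.exp_add]
        congr 2
        push_cast
        ring

theorem achievable_of_small_rates [Nonempty X] [Nonempty Y] {W : MAC X Y Z} (hW : ¬ Spoofable W) :
    ∃ ε > 0, ∀ R : ℝ × ℝ, 0 < R.1 → R.1 < ε → 0 < R.2 → R.2 < ε → Achievable W R := by
  have : Nonempty Z := by
    by_contra h
    rw [not_nonempty_iff] at h
    simpa using (W (Classical.arbitrary X) (Classical.arbitrary Y)).2.2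
  obtain ⟨η₁, hη₁, hsep₁⟩ := exists_separation W fun h => hW (Or.inl h)
  obtain ⟨η₂, hη₂, hsep₂⟩ := exists_separation (swap W) fun h => hW (Or.inr (.of_swap h))
  set η := min (min η₁ η₂) 1 with hη
  have hη0 : 0 < η := lt_min (lt_min hη₁ hη₂) one_pos
  have hη1 : η ≤ 1 := min_le_right _ _
  have hle₁ : η ≤ η₁ := (min_le_left _ _).trans (min_le_left _ _)
  have hle₂ : η ≤ η₂ := (min_le_left _ _).trans (min_le_right _ _)
  have hlog : 0 < Real.log 2 := Real.log_pos one_lt_two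
  refine ⟨η ^ 4 / 4096 / Real.log 2, by positivity, fun R h1 h1' h2 h2' => ?_⟩
  rw [lt_div_iff₀' hlog] at h1' h2'
  refine ⟨h1.le, h2.le, ?_⟩
  set M₁ : ℕ → ℕ := fun n => ⌊(2 : ℝ) ^ ((n : ℝ) * R.1)⌋₊ with hM₁
  set M₂ : ℕ → ℕ := fun n => ⌊(2 : ℝ) ^ ((n : ℝ) * R.2)⌋₊ with hM₂
  have hM₁' : ∀ n : ℕ, (M₁ n : ℝ) ≤ Real.exp (n * (η ^ 4 / 4096)) := floor_rpow_le_exp h1'.le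
  have hM₂' : ∀ n : ℕ, (M₂ n : ℝ) ≤ Real.exp (n * (η ^ 4 / 4096)) := floor_rpow_le_exp h2'.le
  set e : ℕ → ℝ := fun n => rejectBound X Y Z η (M₁ n) n + rejectBound Y X Z η (M₂ n) n with he
  have hetend : Tendsto e atTop (𝓝 0) := by
    simpa using (tendsto_rejectBound (X := X) (Y := Y) (Z := Z) hη0 h1).add
      (tendsto_rejectBound (X := Y) (Y := X) (Z := Z) hη0 h2)
  have hsmall : Tendsto (fun n : ℕ =>
      Fintype.card ((X → Y → Y → Bool) × X) * 2 * Real.exp (-(η ^ 4 / 512) * n) +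
      Fintype.card ((Y → X → X → Bool) × Y) * 2 * Real.exp (-(η ^ 4 / 512) * n))
      atTop (𝓝 0) := by
    have h := tendsto_exp_neg_mul (by positivity : 0 < η ^ 4 / 512)
    simpa using (h.const_mul _).add (h.const_mul _)
  have hcodes : ∀ᶠ n in atTop, ∃ c : Code X Y Z (M₁ n) (M₂ n) n, probErr W c ≤ e n := by
    filter_upwards [hsmall.eventually (gt_mem_nhds one_pos), eventually_gt_atTop 0,
      (tendsto_floor_rpow h1).eventually_ge_atTop 2,
      (tendsto_floor_rpow h2).eventually_ge_atTop 2] with n hn1 hn hA hB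
    obtain ⟨cx, cy, hG₁, hG₂⟩ := exists_goodBook (X := X) (Y := Y) (N₁ := M₁ n) (N₂ := M₂ n)
      (n := n) (δ := η ^ 2 / 8) (by positivity) (by nlinarith)
      ((add_le_add (card_mul_exp_le (hM₁' n) (hM₂' n) _)
        (card_mul_exp_le (hM₂' n) (hM₁' n) _)).trans_lt hn1)
    refine ⟨_, probErr_acceptDecoder_le W (floor_rpow_pos h1.le n) (floor_rpow_pos h2.le n) cx cy
      (fun z i => Accepts W η cx cy z i) (fun z p => Accepts (swap W) η cy cx z p)
      (fun z i j p hi hj hp => hsep₁ _ _ _ hB hn cx cy z i j p (hi.mono hle₁) (hj.mono hle₁)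
        (hp.mono hle₁))
      (fun z p q i hp hq hi => hsep₂ _ _ _ hA hn cy cx z p q i (hp.mono hle₂) (hq.mono hle₂)
        (hi.mono hle₂))
      (sum_blockProb_not_accepts_le_rejectBound W hn hη0 hη1
        (floor_rpow_pos h1.le n) (hM₁' n) (hM₂' n) hG₁)
      (sum_blockProb_not_accepts_le_rejectBound (swap W) hn hη0 hη1
        (floor_rpow_pos h2.le n) (hM₂' n) (hM₁' n) hG₂)⟩
  have hall : ∀ n, ∃ c : Code X Y Z (M₁ n) (M₂ n) n,
      (∃ c' : Code X Y Z (M₁ n) (M₂ n) n, probErr W c' ≤ e n) → probErr W c ≤ e n := by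
    intro n
    by_cases h : ∃ c' : Code X Y Z (M₁ n) (M₂ n) n, probErr W c' ≤ e n
    · exact ⟨h.choose, fun _ => h.choose_spec⟩
    · exact ⟨⟨fun _ _ => Classical.arbitrary X, fun _ _ => Classical.arbitrary Y,
        fun _ => .blame₁⟩, fun h' => absurd h' h⟩
  choose c hc using hall
  refine ⟨c, tendsto_of_tendsto_of_tendsto_of_le_of_le' tendsto_const_nhds hetend
    (Eventually.of_forall fun n => probErr_nonneg W (c n)) ?_⟩
  filter_upwards [hcodes] with n hn using hc n hn

theorem interior_capacityRegion_nonempty {W : MAC X Y Z} (hW : ¬ Spoofable W) :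
    (interior (capacityRegion W)).Nonempty := by
  have : Nonempty X := by
    by_contra h
    rw [not_nonempty_iff] at h
    exact hW (Or.inl ⟨fun x => isEmptyElim x, fun x => isEmptyElim x, fun x => isEmptyElim x⟩)
  have : Nonempty Y := by
    by_contra h
    rw [not_nonempty_iff] at h
    exact hW (Or.inr ⟨fun _ y => isEmptyElim y, fun y => isEmptyElim y, fun _ y => isEmptyElim y⟩)
  obtain ⟨ε, hε, hach⟩ := achievable_of_small_rates hW
  refine ⟨(ε / 2, ε / 2), mem_interior.2 ⟨Set.Ioo 0 ε ×ˢ Set.Ioo 0 ε, fun R hR => ?_,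
    isOpen_Ioo.prod isOpen_Ioo, ?_⟩⟩
  · exact subset_closure (hach R hR.1.1 hR.1.2 hR.2.1 hR.2.2)
  · have : ε / 2 ∈ Set.Ioo 0 ε := ⟨by linarith, by linarith⟩
    exact ⟨this, this⟩

end Achievability

end ByzantineMAC

theorem mainTheorem2 {X Y Z : Type*} [Fintype X] [Fintype Y] [Fintype Z]
    (W : ByzantineMAC.MAC X Y Z) :
    interior (ByzantineMAC.capacityRegion W) = ∅ ↔ ByzantineMAC.Spoofable W := by
  refine ⟨fun h => ?_, ByzantineMAC.Spoofable.interior_capacityRegion⟩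
  by_contra hW
  exact (ByzantineMAC.interior_capacityRegion_nonempty hW).ne_empty h
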